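/- Let $\mathcal M=(S,\mathbf P,\mu,Ap,L)$ be a finite-state labelled Markov chain over a finite set $Ap$ of atomic propositions, let $\mathsf p_{\min}$ be its smallest positive transition probability, let $\varphi$ be an LTL formula over $Ap$ whose probability $p_\varphi=\mathbb P[\mathcal M\models\varphi]$ is positive, and let $\mathcal A=(Q,2^{Ap},\gamma,q_0,Acc)$ be a deterministic Rabin automaton (pairs $(E,F)\in Acc$: $E$ visited finitely often, $F$ infinitely often) that accepts exactly the words satisfying $\varphi$. Let $\mathcal M\otimes\mathcal A$ be the product chain on $S\times Q$: it starts in $(s,\gamma(q_0,L(s)))$ with probability $\mu(s)$ and moves from $(s,q)$ to $(s',\gamma(q,L(s')))$ with probability $\mathbf P(s,s')$. Let $\pi$ be a finite path of $\mathcal M\otimes\mathcal A$, and let $G_\pi$ be the graph of the states and transitions occurring in $\pi$. If $\pi$ has a suffix that spans a bottom strongly connected component of $G_\pi$ (a component has at least one edge), then the set of states of this suffix is the candidate $K(\pi)$; otherwise $K(\pi)=\bot$. A candidate $K$ is good if $K\cap(S\times E)=\emptyset$ and $K\cap(S\times F)\neq\emptyset$ for some $(E,F)\in Acc$, and bad otherwise.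 If $K(\pi)\ne\bot$, write $\pi=\pi' s\,\kappa$ with $\pi'$ the shortest prefix such that $K(\pi' s)=K(\pi)$; the strength $\mathrm{Str}(\pi)$ is the largest $k$ such that every state of $K(\pi)$ occurs at least $k$ times in $s\,\kappa$ and the last state of $s\,\kappa$ occurs there at least $k+1$ times. If $K(\pi)=\bot$, then $\mathrm{Str}(\pi)=0$. The index $i(\pi)$ is the number of candidates seen along $\pi$: start with $C=\bot$, $i=0$, and for each prefix $\pi''$ of $\pi$ in turn, if $\bot\ne K(\pi'')\neq C$, set $C:=K(\pi'')$ and $i:=i+1$. For $\alpha\in\mathbb R$ and $\varepsilon>0$, $\mathrm{BoldMonitor}_{\alpha,\varepsilon}$ is the following Markov chain $\mathcal B$ on pairs $\langle\pi,r\rangle$ of a path and a number of resets. It starts in $\langle\lambda,0\rangle$, with $\lambda$ the empty path. If $K(\pi)$ is bad and $\mathrm{Str}(\pi)\ge\alpha(i(\pi)-\log_2\varepsilon)$, it moves from $\langle\pi,r\rangle$ to $\langle\lambda,r+1\rangle$ (a reset); otherwise it extends $\pi$ by one random step of $\mathcal M\otimes\mathcal A$ and keeps $r$. Let $R\in\mathbb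 N\cup\{\infty\}$ be the number of resets of a run of $\mathcal B$, and let $S_\varphi$ be the event that $R<\infty$ and the run executed after the last reset (the whole run if $R=0$) satisfies $\varphi$. Let $\alpha\ge\alpha_0:=\max\{1,-1/\log_2(1-\mathsf p_{\min})\}$ (with $\alpha_0=1$ if $\mathsf p_{\min}=1$) and $\varepsilon>0$. Then: (a) $R$ is geometrically distributed with success probability at least $p_\varphi(1-\varepsilon)$: there is $p\in(0,1]$ with $p\ge p_\varphi(1-\varepsilon)$ and $\mathbb P_{\mathcal B}[R=k]=(1-p)^k\,p$ for all $k\ge0$. Moreover $\mathbb P_{\mathcal B}[R<\infty]=1$, and if $\varepsilon<1$ then $\mathbb E_{\mathcal B}(R)\le \dfrac{1}{p_\varphi(1-\varepsilon)}$. (b) $\mathbb P_{\mathcal B}[S_\varphi\mid R<\infty]=\mathbb P_{\mathcal B}[S_\varphi]=1$. -/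

import Mathlib

open MeasureTheory ProbabilityTheory Filter
open scoped ENNReal

noncomputable section

/-! ### Markov chains and their run measure -/

/-- A Markov chain with state space `S`: an initial distribution and a stochastic transition
matrix, `step s s'` being the probability of moving from `s` to `s'`. -/
structure MarkovChain (S : Type*) where
  init : PMF S
  step : S → PMF S

/-- Infinite sequences of states. -/
def Run (S : Type*) : Type _ := ℕ → S

/-- The σ-algebra on runs generated by the coordinates, i.e. (for countable `S`) by the cones. -/
instance Run.measurableSpace (S : Type*) : MeasurableSpace (Run S) :=
  @MeasurableSpace.pi ℕ (fun _ => S) (fun _ => ⊤)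

/-- The Markov kernel that sends a history `s₀ … sₙ` to the distribution of the next state. -/
def MarkovChain.kernel {S : Type*} (M : MarkovChain S) (n : ℕ) :
    @Kernel ((i : Finset.Iic n) → S) S (@MeasurableSpace.pi _ (fun _ => S) (fun _ => ⊤)) ⊤ :=
  letI : MeasurableSpace S := ⊤
  (⟨fun s => (M.step s).toMeasure, measurable_from_top⟩ : Kernel S S).comap
    (fun h => h ⟨n, Finset.mem_Iic.2 le_rfl⟩) (measurable_pi_apply _)

instance MarkovChain.kernel_isMarkov {S : Type*} (M : MarkovChain S) (n : ℕ) :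
    letI : MeasurableSpace S := ⊤
    IsMarkovKernel (M.kernel n) := by
  letI : MeasurableSpace S := ⊤
  refine ⟨fun h => ?_⟩
  exact PMF.toMeasure.isProbabilityMeasure (M.step (h ⟨n, Finset.mem_Iic.2 le_rfl⟩))

/-- The probability measure on runs of a Markov chain (Ionescu-Tulcea): the first state has law
`init`, and each further state is drawn from `step` of the current one. -/
def MarkovChain.runMeasure {S : Type*} (M : MarkovChain S) : Measure (Run S) :=
  letI : MeasurableSpace S := ⊤
  Kernel.trajMeasure (X := fun _ => S) M.init.toMeasure M.kernel

/-- The smallest positive transition probability. -/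
def MarkovChain.pmin {S : Type*} (M : MarkovChain S) : ℝ :=
  sInf {x : ℝ | ∃ s t, M.step s t ≠ 0 ∧ x = (M.step s t).toReal}

/-- `α₀ = max {1, -1 / log₂ (1 - pmin)}`. If `pmin = 1`, then `log₂ 0 = -∞` is meant and the
second entry is `0`, which is also the value that Lean's conventions give it. -/
def MarkovChain.alpha0 {S : Type*} (M : MarkovChain S) : ℝ :=
  max 1 (-1 / Real.logb 2 (1 - M.pmin))

/-- A labelled Markov chain over the atomic propositions `Ap`. -/
structure LabelledMarkovChain (S Ap : Type*) extends MarkovChain S where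
  label : S → Set Ap

/-! ### Linear temporal logic -/

/-- LTL formulas over the atomic propositions `Ap`. -/
inductive LTL (Ap : Type*) where
  | tru : LTL Ap
  | atom (a : Ap) : LTL Ap
  | neg (f : LTL Ap) : LTL Ap
  | conj (f g : LTL Ap) : LTL Ap
  | nextTime (f : LTL Ap) : LTL Ap
  | untl (f g : LTL Ap) : LTL Ap

/-- Satisfaction of an LTL formula by an infinite word over `2^Ap`. -/
def LTL.Sat {Ap : Type*} : LTL Ap → (ℕ → Set Ap) → Prop
  | .tru, _ => True
  | .atom a, w => a ∈ w 0
  | .neg f, w => ¬ f.Sat w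
  | .conj f g, w => f.Sat w ∧ g.Sat w
  | .nextTime f, w => f.Sat (fun n => w (n + 1))
  | .untl f g, w => ∃ k, g.Sat (fun n => w (n + k)) ∧ ∀ j < k, f.Sat (fun n => w (n + j))

/-- `p_φ`: the probability that a run of the labelled Markov chain satisfies `φ`. -/
def LabelledMarkovChain.prob {S Ap : Type*} (M : LabelledMarkovChain S Ap) (φ : LTL Ap) : ℝ :=
  M.runMeasure.real {ρ | φ.Sat (fun n => M.label (ρ n))}

/-! ### Deterministic Rabin automata and the product chain -/

/-- A deterministic Rabin automaton with input alphabet `A` and state set `Q`; `acc` is the set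
of Rabin pairs `(E, F)`. -/
structure DRA (A Q : Type*) where
  step : Q → A → Q
  start : Q
  acc : Set (Set Q × Set Q)

/-- The run of the automaton on an infinite word. -/
def DRA.run {A Q : Type*} (D : DRA A Q) (w : ℕ → A) : ℕ → Q
  | 0 => D.start
  | n + 1 => D.step (D.run w n) (w n)

/-- Rabin acceptance: for some pair `(E, F)`, no state of `E` and some state of `F` is visited
infinitely often. -/
def DRA.Accepts {A Q : Type*} (D : DRA A Q) (w : ℕ → A) : Prop :=
  ∃ p ∈ D.acc, (∀ q ∈ p.1, ¬ ∃ᶠ n in atTop, D.run w n = q) ∧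
    ∃ q ∈ p.2, ∃ᶠ n in atTop, D.run w n = q

/-- The product chain `M ⊗ D`: from `(s, q)` move to `(s', γ(q, L(s')))` with probability
`P(s, s')`; initially take `(s, γ(q₀, L(s)))` with probability `μ(s)`. -/
def LabelledMarkovChain.product {S Ap Q : Type*} (M : LabelledMarkovChain S Ap)
    (D : DRA (Set Ap) Q) : MarkovChain (S × Q) where
  init := M.init.map fun s => (s, D.step D.start (M.label s))
  step := fun x => (M.step x.1).map fun s' => (s', D.step x.2 (M.label s'))

/-- A set of product states is good if some Rabin pair `(E, F)` satisfies
`K ∩ (S × E) = ∅` and `K ∩ (S × F) ≠ ∅`. -/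
def DRA.Good {A Q : Type*} (D : DRA A Q) {S : Type*} (K : Set (S × Q)) : Prop :=
  ∃ p ∈ D.acc, (∀ x ∈ K, x.2 ∉ p.1) ∧ ∃ x ∈ K, x.2 ∈ p.2

/-! ### Candidates and strengths of finite paths -/

/-- The edges of the graph of a finite path: pairs of consecutive states. -/
def pathEdge {V : Type*} (π : List V) (u v : V) : Prop := [u, v] <:+: π

/-- `B` is the vertex set of a bottom strongly connected component of the graph with edge
relation `E`. Strong connectedness asks for paths with at least one edge, so that a single
vertex without a self-loop does not count. Maximality is automatic, as no edge leaves `B`. -/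
def IsBSCC {V : Type*} (E : V → V → Prop) (B : Set V) : Prop :=
  B.Nonempty ∧ (∀ u ∈ B, ∀ v ∈ B, Relation.TransGen E u v) ∧ ∀ u ∈ B, ∀ v, E u v → v ∈ B

/-- `B` is the support of a suffix `κ` of `π` that spans a BSCC of the graph of `π`. (Once `π`
has entered a BSCC of its graph it stays there, so the longest such `κ` traverses all edges of
the BSCC.) -/
def IsCandidate {V : Type*} (π : List V) (B : Set V) : Prop :=
  ∃ κ : List V, κ <:+ π ∧ B = {v | v ∈ κ} ∧ IsBSCC (pathEdge π) B

/-- A path has at most one candidate. -/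
theorem IsCandidate.unique {V : Type*} {π : List V} {B C : Set V} (hB : IsCandidate π B)
    (hC : IsCandidate π C) : B = C := by
  have key : ∀ {B C : Set V}, IsCandidate π B → IsCandidate π C → B ⊆ C := by
    rintro B C ⟨κ, hκ, rfl, hne, hc, hb⟩ ⟨κ', hκ', rfl, hne', -, hb'⟩
    obtain ⟨v, hv⟩ := hne
    obtain ⟨v', hv'⟩ := hne'
    have h1 : κ ≠ [] := List.ne_nil_of_mem hv
    have h2 : κ' ≠ [] := List.ne_nil_of_mem hv'
    have hl : κ.getLast h1 ∈ {x | x ∈ κ'} := by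
      have h : κ.getLast h1 = κ'.getLast h2 := by
        obtain ⟨t, rfl⟩ := hκ
        obtain ⟨t', ht'⟩ := hκ'
        have := congrArg List.getLast? ht'
        rw [List.getLast?_append_of_ne_nil _ h2, List.getLast?_append_of_ne_nil _ h1,
          List.getLast?_eq_some_getLast h1, List.getLast?_eq_some_getLast h2] at this
        exact (Option.some.inj this).symm
      rw [h]; exact List.getLast_mem h2
    intro u hu
    have hr := hc _ (List.getLast_mem h1) u hu
    clear hu
    induction hr with
    | single h => exact hb' _ hl _ h
    | tail _ h ih => exact hb' _ ih _ h
  exact Set.Subset.antisymm (key hB hC) (key hC hB)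

open Classical in
/-- `K(π)`: the candidate of `π`; `none` stands for `⊥`. -/
def candidate {V : Type*} (π : List V) : Option (Set V) :=
  if h : ∃ B, IsCandidate π B then some h.choose else none

open Classical in
/-- `Str(π)`. Write `π = π' s κ` with `π'` the shortest prefix such that `K(π' s) = K(π)`. The
strength is the largest `k` such that every state of `K(π)` occurs at least `k` times in `s κ`
and the last state of `s κ` occurs at least `k + 1` times there; it is `0` if `K(π) = ⊥`. -/
def strength {V : Type*} (π : List V) : ℕ :=
  match candidate π with
  | none => 0
  | some B =>
    let sκ := π.drop (sInf {n | candidate (π.take (n + 1)) = candidate π})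
    sSup {k | (∀ v ∈ B, k ≤ sκ.count v) ∧ ∀ v ∈ sκ.getLast?, k + 1 ≤ sκ.count v}

open Classical in
/-- One execution of the `if` statement of the monitor's loop on the pair `(C, i)` of the current
candidate and the candidate counter: if `⊥ ≠ K(π) ≠ C`, then `C ← K(π)` and `i ← i + 1`. -/
def updateCandidate {V : Type*} (c : Option (Set V) × ℕ) (π : List V) : Option (Set V) × ℕ :=
  if candidate π ≠ none ∧ candidate π ≠ c.1 then (candidate π, c.2 + 1) else c

/-- The value of the candidate counter `i` after the path `π` has been read, starting from
`C = ⊥`, `i = 0` and updating on every prefix of `π` (the empty one has no effect). -/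
def candidateIndex {V : Type*} (π : List V) : ℕ :=
  (π.inits.foldl updateCandidate (none, 0)).2

/-! ### The bold monitor -/

/-- The condition of the monitor's `until`: the candidate of `π` is defined and bad, and its
strength is at least `α (i - log₂ ε)`, where `i` is the index of the candidate. -/
def ResetCondition {S A Q : Type*} (D : DRA A Q) (α ε : ℝ) (π : List (S × Q)) : Prop :=
  (∃ K, candidate π = some K ∧ ¬ D.Good K) ∧
    α * ((candidateIndex π : ℝ) - Real.logb 2 ε) ≤ (strength π : ℝ)

/-- The distribution of the next state of a chain after a finite path. -/
def MarkovChain.nextState {V : Type*} (N : MarkovChain V) (π : List V) : PMF V :=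
  match π.getLast? with
  | none => N.init
  | some v => N.step v

open Classical in
/-- The Markov chain of the bold monitor running on the product of `M` and `D`. Its states are the
pairs `⟨π, r⟩` of the current path of the product chain and the number of resets so far; it starts
in `⟨λ, 0⟩`. If the reset condition holds of `π`, it moves to `⟨λ, r + 1⟩`; otherwise it extends
`π` by one step of the product chain. -/
def boldMonitor {S Ap Q : Type*} (M : LabelledMarkovChain S Ap) (D : DRA (Set Ap) Q) (α ε : ℝ) :
    MarkovChain (List (S × Q) × ℕ) where
  init := PMF.pure ([], 0)
  step := fun x =>
    if ResetCondition D α ε x.1 then PMF.pure ([], x.2 + 1)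
    else ((M.product D).nextState x.1).map fun v => (x.1 ++ [v], x.2)

/-- `R`: the number of resets along a run of the monitor. -/
def resets {V : Type*} (ρ : Run (List V × ℕ)) : ℕ∞ := ⨆ n, ((ρ n).2 : ℕ∞)

/-- The execution after the last reset starts at position `n` of `ρ`: there is no reset at or
after position `n`, and either `n = 0` or the step into position `n` is a reset. -/
def IsLastStart {V : Type*} (ρ : Run (List V × ℕ)) (n : ℕ) : Prop :=
  (∀ m, n ≤ m → (ρ m).2 = (ρ n).2) ∧ (n = 0 ∨ (ρ (n - 1)).2 ≠ (ρ n).2)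

/-- `S_φ`: there are finitely many resets, and the run `σ` of the product chain that is executed
after the last reset satisfies `φ`. -/
def finalRunSatisfies {S Ap : Type*} (Q : Type*) (M : LabelledMarkovChain S Ap) (φ : LTL Ap) :
    Set (Run (List (S × Q) × ℕ)) :=
  {ρ | resets ρ < ⊤ ∧ ∃ n, IsLastStart ρ n ∧ ∃ σ : ℕ → S × Q,
    (∀ k, (ρ (n + k)).1 = (List.range k).map σ) ∧ φ.Sat (fun k => M.label (σ k).1)}

end

/-! Let `h x` be the probability that the run of the product chain from `x` has a good limit set
(`accProb`). Rabin acceptance depends only on the limit set, so the mean of `h` over the initial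
states is `p_φ`. The function `h` is harmonic and vanishes on bad closed strongly connected sets.

A reset takes the monitor back to the empty path and changes only the counter. Hence `R` is
geometric, and its parameter `p` is the probability that the monitor never resets
(`restartChain_law_resets`).

The bound `p ≥ p_φ (1 - ε)` comes from weighting paths with `h`, in effect conditioning on
acceptance; this makes the error `p_φ ε` and not `ε`. A reset at a bad closed candidate has weight
zero. For a strongly connected `K` that is not closed, the maximum principle
(`exists_exit_of_harmonic`) gives `z ∈ K` with an exit to some `t ∉ K` such that `h t ≥ h z`, so in
the weighted chain every visit to `z` leaves `K` with probability at least `pmin`. Strength `k`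
means that `z` has been left at least `k` times without leaving `K`, which has weight at most `(1 -
pmin) ^ k`. The threshold for the `i`-th candidate makes this at most `ε / 2 ^ i`
(`one_sub_pow_ceil_le`), and these bounds add up to `ε` over `i ≥ 1`. A supermartingale
(`RiskBound.tsum_risk_le`) does the bookkeeping: it adds the risk of the current candidate to a
budget for all later ones.

For `ε ≥ 1` this bound is void, but `p > 0` is still needed. A finite path of positive probability
is built that leads into a good bottom component and after which every candidate contains one fixed
accepting state (`exists_le_stayProb`).

For (b), recurrence is proved in the monitor chain and transferred to the run `σ` after the last
reset: its limit set is closed, hence from some time on it is the candidate, with constant index and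
unbounded strength. If it were bad, there would be another reset. So it is good, and `σ` satisfies
`φ`. -/

/-! ### The run measure of a Markov chain -/

/-- The set of runs that agree with `g` up to time `n`. -/
def Run.cyl {V : Type*} (n : ℕ) (g : ℕ → V) : Set (Run V) := {ω | ∀ i ≤ n, ω i = g i}

/-- Prepend a state to a run. -/
def Run.cons {V : Type*} (x : V) (ω : Run V) : Run V := fun n => Nat.casesOn n x ω

@[simp] theorem Run.cons_zero {V : Type*} (x : V) (ω : Run V) : Run.cons x ω 0 = x := rfl

@[simp] theorem Run.cons_succ {V : Type*} (x : V) (ω : Run V) (n : ℕ) :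
    Run.cons x ω (n + 1) = ω n := rfl

theorem Run.measurableSet_coord {V : Type*} (n : ℕ) (A : Set V) :
    MeasurableSet {ω : Run V | ω n ∈ A} := by
  let : MeasurableSpace V := ⊤
  exact measurable_pi_apply (X := fun _ : ℕ => V) n (show MeasurableSet A from trivial)

theorem Run.measurable_of_coord {V α : Type*} [MeasurableSpace α] {f : α → Run V}
    (h : ∀ (n : ℕ) (A : Set V), MeasurableSet {a | f a n ∈ A}) : Measurable f := by
  let : MeasurableSpace V := ⊤
  exact measurable_pi_lambda (X := fun _ : ℕ => V) f fun n A _ => h n A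

theorem Run.measurable_cons {V : Type*} (x : V) : Measurable (Run.cons x) := by
  refine Run.measurable_of_coord fun n A => ?_
  cases n with
  | zero => exact MeasurableSet.const (x ∈ A)
  | succ n => exact Run.measurableSet_coord n A

theorem Run.measurableSet_coord₂ {V : Type*} [Countable V] (m n : ℕ) (p : V → V → Prop) :
    MeasurableSet {ω : Run V | p (ω m) (ω n)} := by
  have : {ω : Run V | p (ω m) (ω n)} =
      ⋃ x : V, {ω : Run V | ω m ∈ ({x} : Set V)} ∩ {ω : Run V | ω n ∈ {y | p x y}} := by
    ext ω; simp
  rw [this]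
  exact MeasurableSet.iUnion fun x =>
    (Run.measurableSet_coord m _).inter (Run.measurableSet_coord n _)

theorem Run.measurableSet_cyl {V : Type*} (n : ℕ) (g : ℕ → V) :
    MeasurableSet (Run.cyl n g) := by
  have : Run.cyl n g = ⋂ i : ℕ, ⋂ _ : i ≤ n, {ω : Run V | ω i ∈ ({g i} : Set V)} := by
    ext ω; simp [Run.cyl]
  rw [this]
  exact MeasurableSet.iInter fun i => MeasurableSet.iInter fun _ => Run.measurableSet_coord i _

theorem Run.generateFrom_cyl {V : Type*} [Countable V] :
    Run.measurableSpace V = MeasurableSpace.generateFrom {s | ∃ n g, s = Run.cyl n g} := by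
  apply le_antisymm
  · refine iSup_le fun n => ?_
    rintro s ⟨A, -, rfl⟩
    have : (fun ω : Run V => ω n) ⁻¹' A =
        ⋃ l : {l : Fin (n + 1) → V // l (Fin.last n) ∈ A},
          Run.cyl n (fun i => l.1 (Fin.ofNat (n + 1) i)) := by
      ext ω
      simp only [Set.mem_preimage, Set.mem_iUnion, Run.cyl, Set.mem_ofPred_eq]
      constructor
      · intro h
        refine ⟨⟨fun i => ω i, by simpa using h⟩, fun i hi => ?_⟩
        simp [Fin.ofNat, Nat.mod_eq_of_lt (Nat.lt_succ_of_le hi)]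
      · rintro ⟨⟨l, hl⟩, h⟩
        have := h n le_rfl
        rw [this]
        convert hl
        ext; simp [Fin.ofNat]
    change MeasurableSet[MeasurableSpace.generateFrom _] ((fun ω : Run V => ω n) ⁻¹' A)
    rw [this]
    exact MeasurableSet.iUnion fun l => MeasurableSpace.measurableSet_generateFrom ⟨_, _, rfl⟩
  · refine MeasurableSpace.generateFrom_le ?_
    rintro s ⟨n, g, rfl⟩
    exact Run.measurableSet_cyl n g

theorem Run.isPiSystem_cyl {V : Type*} :
    IsPiSystem {s : Set (Run V) | ∃ n g, s = Run.cyl n g} := by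
  rintro _ ⟨n, g, rfl⟩ _ ⟨m, g', rfl⟩ ⟨ω, h1, h2⟩
  refine ⟨max n m, ω, ?_⟩
  ext ω'
  simp only [Run.cyl, Set.mem_inter_iff, Set.mem_ofPred_eq] at *
  constructor
  · rintro ⟨h3, h4⟩ i hi
    rcases le_max_iff.1 hi with h | h
    · rw [h3 i h, h1 i h]
    · rw [h4 i h, h2 i h]
  · intro h
    exact ⟨fun i hi => by rw [h i (le_max_of_le_left hi), h1 i hi],
      fun i hi => by rw [h i (le_max_of_le_right hi), h2 i hi]⟩

/-- Probability measures on runs are determined by the cylinders. -/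
theorem Run.measure_ext {V : Type*} [Countable V] {μ ν : Measure (Run V)}
    [IsProbabilityMeasure μ] [IsProbabilityMeasure ν]
    (h : ∀ n g, μ (Run.cyl n g) = ν (Run.cyl n g)) : μ = ν := by
  refine ext_of_generate_finite _ Run.generateFrom_cyl Run.isPiSystem_cyl ?_ (by simp)
  rintro _ ⟨n, g, rfl⟩
  exact h n g

instance MarkovChain.runMeasure_isProbabilityMeasure {V : Type*} (N : MarkovChain V) :
    IsProbabilityMeasure N.runMeasure := by
  let : MeasurableSpace V := ⊤
  have := PMF.toMeasure.isProbabilityMeasure N.init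
  unfold MarkovChain.runMeasure
  exact inferInstanceAs (IsProbabilityMeasure (Kernel.trajMeasure (X := fun _ => V) _ _))

/-- The law of the history up to `n`, composed with the kernel, is the joint law of that history and
the next state. On a rectangle of singletons the kernel is constant, so the integral becomes a
product. -/
theorem MarkovChain.runMeasure_cyl_succ {V : Type*} [Countable V] (N : MarkovChain V) (n : ℕ)
    (g : ℕ → V) : N.runMeasure (Run.cyl (n + 1) g) =
      N.runMeasure (Run.cyl n g) * N.step (g n) (g (n + 1)) := by
  let : MeasurableSpace V := ⊤
  have : DiscreteMeasurableSpace V := ⟨fun _ => trivial⟩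
  have := PMF.toMeasure.isProbabilityMeasure N.init
  have key := Kernel.map_frestrictLe_trajMeasure_compProd_eq_map_trajMeasure (X := fun _ => V)
    (κ := N.kernel) (μ₀ := N.init.toMeasure) (a := n)
  have hs : MeasurableSet {h : (i : Finset.Iic n) → V | ∀ i, h i = g i} := by
    have he : {h : (i : Finset.Iic n) → V | ∀ i, h i = g i} =
        {fun i : Finset.Iic n => g i} := by
      ext h; simp [funext_iff]
    rw [he]; exact measurableSet_singleton _
  have ht : MeasurableSet ({g (n + 1)} : Set V) := trivial
  have h1 := congrArg (fun μ => μ ({h : (i : Finset.Iic n) → V | ∀ i, h i = g i} ×ˢ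
    ({g (n + 1)} : Set V))) key
  beta_reduce at h1
  rw [Measure.compProd_apply_prod hs ht, Measure.map_apply (by fun_prop) (hs.prod ht)] at h1
  have h2 : ∀ h ∈ {h : (i : Finset.Iic n) → V | ∀ i, h i = g i},
      N.kernel n h {g (n + 1)} = N.step (g n) (g (n + 1)) := by
    intro h hh
    have : N.kernel n h = (N.step (h ⟨n, Finset.mem_Iic.2 le_rfl⟩)).toMeasure := rfl
    rw [this, PMF.toMeasure_apply_singleton _ _ ht, hh]
  rw [setLIntegral_congr_fun hs h2, setLIntegral_const,
    Measure.map_apply (by fun_prop) hs] at h1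
  have e1 : (fun x : ℕ → V => (Preorder.frestrictLe (π := fun _ => V) n x, x (n + 1))) ⁻¹'
      ({h : (i : Finset.Iic n) → V | ∀ i, h i = g i} ×ˢ ({g (n + 1)} : Set V)) =
      Run.cyl (n + 1) g := by
    ext ω
    simp only [Set.mem_preimage, Set.mem_prod, Set.mem_ofPred_eq, Run.cyl, Subtype.forall,
      Finset.mem_Iic, Preorder.frestrictLe_apply, Set.mem_singleton_iff]
    constructor
    · rintro ⟨h, h'⟩ i hi
      rcases Nat.le_succ_iff.1 hi with h3 | h3
      · exact h i h3
      · rw [h3]; exact h'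
    · intro h
      exact ⟨fun i hi => h i (hi.trans n.le_succ), h _ le_rfl⟩
  have e2 : (Preorder.frestrictLe (π := fun _ => V) n) ⁻¹'
      {h : (i : Finset.Iic n) → V | ∀ i, h i = g i} = Run.cyl n g := by
    ext ω
    simp only [Run.cyl, Set.mem_preimage, Set.mem_ofPred_eq, Subtype.forall, Finset.mem_Iic,
      Preorder.frestrictLe_apply]
    rfl
  rw [e1, e2, mul_comm] at h1
  exact h1.symm

theorem MarkovChain.runMeasure_cyl_zero {V : Type*} [Countable V] (N : MarkovChain V)
    (g : ℕ → V) : N.runMeasure (Run.cyl 0 g) = N.init (g 0) := by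
  let : MeasurableSpace V := ⊤
  have : DiscreteMeasurableSpace V := ⟨fun _ => trivial⟩
  have := PMF.toMeasure.isProbabilityMeasure N.init
  have h0 : (Kernel.trajMeasure (X := fun _ => V) N.init.toMeasure N.kernel).map
      (Preorder.frestrictLe (π := fun _ => V) 0) =
      N.init.toMeasure.map (MeasurableEquiv.piUnique (fun _ : Finset.Iic 0 => V)).symm := by
    unfold Kernel.trajMeasure
    rw [Measure.map_comp _ _ (by fun_prop), Kernel.traj_map_frestrictLe, Kernel.partialTraj_self,
      Measure.id_comp]
  have hs : MeasurableSet {h : (i : Finset.Iic 0) → V | ∀ i, h i = g i} := by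
    have he : {h : (i : Finset.Iic 0) → V | ∀ i, h i = g i} =
        {fun i : Finset.Iic 0 => g i} := by
      ext h; simp [funext_iff]
    rw [he]; exact measurableSet_singleton _
  have h1 := congrArg (fun μ => μ {h : (i : Finset.Iic 0) → V | ∀ i, h i = g i}) h0
  beta_reduce at h1
  rw [Measure.map_apply (by fun_prop) hs, Measure.map_apply (by fun_prop) hs] at h1
  have e2 : (Preorder.frestrictLe (π := fun _ => V) 0) ⁻¹'
      {h : (i : Finset.Iic 0) → V | ∀ i, h i = g i} = Run.cyl 0 g := by
    ext ω
    simp only [Run.cyl, Set.mem_preimage, Set.mem_ofPred_eq, Subtype.forall, Finset.mem_Iic,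
      Preorder.frestrictLe_apply]
    rfl
  have e3 : (MeasurableEquiv.piUnique (fun _ : Finset.Iic 0 => V)).symm ⁻¹'
      {h : (i : Finset.Iic 0) → V | ∀ i, h i = g i} = {g 0} := by
    ext v
    simp [MeasurableEquiv.piUnique]
  rw [e2, e3, PMF.toMeasure_apply_singleton _ _
    (show MeasurableSet ({g 0} : Set V) from trivial)] at h1
  exact h1

theorem MarkovChain.runMeasure_cyl {V : Type*} [Countable V] (N : MarkovChain V) (n : ℕ)
    (g : ℕ → V) : N.runMeasure (Run.cyl n g) =
      N.init (g 0) * ∏ i ∈ Finset.range n, N.step (g i) (g (i + 1)) := by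
  induction n with
  | zero => simp [N.runMeasure_cyl_zero]
  | succ n ih => rw [N.runMeasure_cyl_succ, ih, Finset.prod_range_succ, mul_assoc]

/-- The law of the runs that start in `x`. -/
noncomputable def MarkovChain.law {V : Type*} (N : MarkovChain V) (x : V) : Measure (Run V) :=
  (MarkovChain.mk (PMF.pure x) N.step).runMeasure

instance MarkovChain.law_isProbabilityMeasure {V : Type*} (N : MarkovChain V) (x : V) :
    IsProbabilityMeasure (N.law x) :=
  MarkovChain.runMeasure_isProbabilityMeasure _

theorem isProbabilityMeasure_sum_pmf {V Ω : Type*} [MeasurableSpace Ω] (p : PMF V)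
    (μ : V → Measure Ω) [∀ x, IsProbabilityMeasure (μ x)] :
    IsProbabilityMeasure (Measure.sum fun x => p x • μ x) := by
  constructor
  rw [Measure.sum_apply _ MeasurableSet.univ]
  simp [p.tsum_coe]

theorem MarkovChain.law_cyl {V : Type*} [Countable V] (N : MarkovChain V) (x : V) (n : ℕ)
    (g : ℕ → V) [Decidable (g 0 = x)] : N.law x (Run.cyl n g) =
      (if g 0 = x then 1 else 0) * ∏ i ∈ Finset.range n, N.step (g i) (g (i + 1)) := by
  classical
  rw [MarkovChain.law, MarkovChain.runMeasure_cyl]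
  simp only [PMF.pure_apply]
  congr

theorem MarkovChain.runMeasure_eq_sum {V : Type*} [Countable V] (N : MarkovChain V) :
    N.runMeasure = Measure.sum fun x => N.init x • N.law x := by
  classical
  have := isProbabilityMeasure_sum_pmf N.init N.law
  refine Run.measure_ext fun n g => ?_
  rw [Measure.sum_apply _ (Run.measurableSet_cyl n g), N.runMeasure_cyl,
    tsum_eq_single (g 0)]
  · simp [N.law_cyl]
  · intro x hx
    simp [N.law_cyl, hx.symm]

/-- First-step decomposition: on a cylinder only `y = g 1` contributes, and it supplies the first
factor of the product of transition probabilities. -/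
theorem MarkovChain.law_eq_sum {V : Type*} [Countable V] (N : MarkovChain V) (x : V) :
    N.law x = Measure.sum fun y => N.step x y • (N.law y).map (Run.cons x) := by
  classical
  have : ∀ y, IsProbabilityMeasure ((N.law y).map (Run.cons x)) := fun y =>
    Measure.isProbabilityMeasure_map (Run.measurable_cons x).aemeasurable
  have := isProbabilityMeasure_sum_pmf (N.step x) fun y => (N.law y).map (Run.cons x)
  refine Run.measure_ext fun n g => ?_
  rw [Measure.sum_apply _ (Run.measurableSet_cyl n g), N.law_cyl]
  simp only [Measure.smul_apply, smul_eq_mul,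
    Measure.map_apply (Run.measurable_cons x) (Run.measurableSet_cyl n g)]
  by_cases hx : g 0 = x
  · subst hx
    cases n with
    | zero =>
      have : Run.cons (g 0) ⁻¹' Run.cyl 0 g = Set.univ := by
        ext ω; simp [Run.cyl]
      simp [this, PMF.tsum_coe]
    | succ n =>
      have : Run.cons (g 0) ⁻¹' Run.cyl (n + 1) g = Run.cyl n (fun i => g (i + 1)) := by
        ext ω
        simp only [Run.cyl, Set.mem_preimage, Set.mem_ofPred_eq]
        constructor
        · intro h i hi
          exact h (i + 1) (by omega)
        · intro h i hi
          cases i with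
          | zero => rfl
          | succ i => exact h i (by omega)
      rw [this, tsum_eq_single (g 1), N.law_cyl, Finset.prod_range_succ']
      · simp [mul_comm]
      · intro y hy
        simp [N.law_cyl, hy.symm]
  · have : Run.cons x ⁻¹' Run.cyl n g = ∅ := by
      ext ω
      simp only [Run.cyl, Set.mem_preimage, Set.mem_ofPred_eq, Set.mem_empty_iff_false, iff_false]
      intro h
      exact hx (h 0 (Nat.zero_le _)).symm
    simp [this, hx]

theorem MarkovChain.runMeasure_apply {V : Type*} [Countable V] (N : MarkovChain V)
    {B : Set (Run V)} (hB : MeasurableSet B) : N.runMeasure B = ∑' x, N.init x * N.law x B := by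
  conv_lhs => rw [N.runMeasure_eq_sum]
  simp [Measure.sum_apply _ hB]

/-- The Markov property at time one. -/
theorem MarkovChain.law_apply {V : Type*} [Countable V] (N : MarkovChain V) (x : V)
    {B : Set (Run V)} (hB : MeasurableSet B) :
    N.law x B = ∑' y, N.step x y * N.law y (Run.cons x ⁻¹' B) := by
  conv_lhs => rw [N.law_eq_sum]
  simp [Measure.sum_apply _ hB, Measure.map_apply (Run.measurable_cons x) hB]

theorem MarkovChain.law_start {V : Type*} [Countable V] (N : MarkovChain V) (x : V) :
    ∀ᵐ ω ∂N.law x, ω 0 = x := by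
  have hm : MeasurableSet {ω : Run V | ω 0 ∈ ({x}ᶜ : Set V)} := Run.measurableSet_coord 0 _
  have : N.law x {ω : Run V | ω 0 ∈ ({x}ᶜ : Set V)} = 0 := by
    rw [N.law_apply x hm]
    simp
  rw [ae_iff]
  simpa using this

theorem MarkovChain.law_eq_zero_iff {V : Type*} [Countable V] (N : MarkovChain V) (x : V)
    {B : Set (Run V)} (hB : MeasurableSet B) :
    N.law x B = 0 ↔ ∀ y, N.step x y ≠ 0 → N.law y (Run.cons x ⁻¹' B) = 0 := by
  rw [N.law_apply x hB]
  simp [or_iff_not_imp_left]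

/-- Almost surely, all transitions have positive probability. -/
theorem MarkovChain.law_ae_step {V : Type*} [Countable V] (N : MarkovChain V) (x : V) :
    ∀ᵐ ω ∂N.law x, ∀ n, N.step (ω n) (ω (n + 1)) ≠ 0 := by
  rw [ae_all_iff]
  intro n
  rw [ae_iff]
  induction n generalizing x with
  | zero =>
    rw [N.law_eq_zero_iff x (Run.measurableSet_coord₂ 0 1 fun a b => ¬ N.step a b ≠ 0)]
    intro y hy
    refine measure_mono_null ?_ (ae_iff.1 (N.law_start y))
    intro ω hω hω'
    simp only [Set.mem_preimage, Set.mem_ofPred_eq, Run.cons_zero] at hω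
    exact hω (by simpa [Run.cons, hω'] using hy)
  | succ n ih =>
    rw [N.law_eq_zero_iff x
      (Run.measurableSet_coord₂ (n + 1) (n + 2) fun a b => ¬ N.step a b ≠ 0)]
    intro y hy
    exact ih y

/-! ### Recurrence -/

theorem frequently_atTop_succ_iff {p : ℕ → Prop} :
    (∃ᶠ n in atTop, p (n + 1)) ↔ ∃ᶠ n in atTop, p n := by
  conv_rhs => rw [← map_add_atTop_eq_nat 1, frequently_map]

theorem Run.measurableSet_frequently {V : Type*} [Countable V] (p : V → V → Prop) :
    MeasurableSet {ω : Run V | ∃ᶠ n in atTop, p (ω n) (ω (n + 1))} := by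
  have : {ω : Run V | ∃ᶠ n in atTop, p (ω n) (ω (n + 1))} =
      ⋂ a : ℕ, ⋃ b : ℕ, ⋃ _ : a ≤ b, {ω : Run V | p (ω b) (ω (b + 1))} := by
    ext ω; simp [frequently_atTop]
  rw [this]
  exact MeasurableSet.iInter fun a => MeasurableSet.iUnion fun b => MeasurableSet.iUnion fun _ =>
    Run.measurableSet_coord₂ b (b + 1) p

theorem Run.measurableSet_forall_ge {V : Type*} [Countable V] (m : ℕ) (p : V → V → Prop) :
    MeasurableSet {ω : Run V | ∀ n, m ≤ n → p (ω n) (ω (n + 1))} := by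
  have : {ω : Run V | ∀ n, m ≤ n → p (ω n) (ω (n + 1))} =
      ⋂ a : ℕ, ⋂ _ : m ≤ a, {ω : Run V | p (ω a) (ω (a + 1))} := by
    ext ω; simp
  rw [this]
  exact MeasurableSet.iInter fun a => MeasurableSet.iInter fun _ =>
    Run.measurableSet_coord₂ a (a + 1) p

/-- For `m = 0`, let `s` be the supremum over all starting states of the probability of the event.
From a state of `A` the move to `Y` destroys the event, which costs at least `q * s`; from any other
state the event forces a visit to `A` first. So `s ≤ s - q * s`, which leaves only `s = 0`. Sets
instead of single states are needed because the states of the monitor contain the whole path and do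
not recur. -/
theorem MarkovChain.law_frequently_avoid {V : Type*} [Countable V] (N : MarkovChain V)
    {A Y : Set V} {q : ℝ≥0∞} (hq : q ≠ 0) (h : ∀ x ∈ A, ∃ y ∈ Y, q ≤ N.step x y) (m : ℕ) (x : V) :
    N.law x {ω | (∃ᶠ n in atTop, ω n ∈ A) ∧ ∀ n, m ≤ n → ¬ (ω n ∈ A ∧ ω (n + 1) ∈ Y)} = 0 := by
  have hmF : MeasurableSet {ω : Run V | ∃ᶠ n in atTop, ω n ∈ A} :=
    Run.measurableSet_frequently fun a _ => a ∈ A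
  have hmZ : ∀ m, MeasurableSet {ω : Run V | (∃ᶠ n in atTop, ω n ∈ A) ∧
      ∀ n, m ≤ n → ¬ (ω n ∈ A ∧ ω (n + 1) ∈ Y)} := fun m =>
    hmF.inter (Run.measurableSet_forall_ge m fun a b => ¬ (a ∈ A ∧ b ∈ Y))
  induction m generalizing x with
  | succ m ih =>
    rw [N.law_eq_zero_iff x (hmZ _)]
    intro y _
    refine measure_mono_null ?_ (ih y)
    rintro ω ⟨h1, h2⟩
    exact ⟨frequently_atTop_succ_iff.2 h1,
      fun n hn => h2 (n + 1) (by omega)⟩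
  | zero =>
    set Z : Set (Run V) := {ω | (∃ᶠ n in atTop, ω n ∈ A) ∧
      ∀ n, 0 ≤ n → ¬ (ω n ∈ A ∧ ω (n + 1) ∈ Y)} with hZ
    have hcons : ∀ x, Run.cons x ⁻¹' Z ⊆ Z := by
      rintro x ω ⟨h1, h2⟩
      exact ⟨frequently_atTop_succ_iff.2 h1,
        fun n _ => h2 (n + 1) (by omega)⟩
    set s : ℝ≥0∞ := ⨆ x, N.law x Z with hs
    have hle : ∀ x, N.law x Z ≤ s := fun x => le_iSup (fun x => N.law x Z) x
    have hs1 : s ≤ 1 := iSup_le fun x => prob_le_one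
    have hqs : ∀ x ∈ A, q * s ≠ ∞ := by
      intro x hx
      obtain ⟨y, -, hy⟩ := h x hx
      exact ENNReal.mul_ne_top ((hy.trans (PMF.coe_le_one _ _)).trans_lt ENNReal.one_lt_top).ne
        (hs1.trans_lt ENNReal.one_lt_top).ne
    have hA : ∀ x ∈ A, N.law x Z ≤ s - q * s := by
      intro x hx
      obtain ⟨y, hyY, hy⟩ := h x hx
      refine ENNReal.le_sub_of_add_le_right (hqs x hx) ?_
      rw [N.law_apply x (hmZ 0)]
      have h0 : N.law y (Run.cons x ⁻¹' Z) = 0 := by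
        refine measure_mono_null ?_ (ae_iff.1 (N.law_start y))
        rintro ω ⟨-, h2⟩ hω
        exact h2 0 le_rfl ⟨hx, by simpa [Run.cons, hω] using hyY⟩
      classical
      calc ∑' z, N.step x z * N.law z (Run.cons x ⁻¹' Z) + q * s
          ≤ ∑' z, N.step x z * N.law z (Run.cons x ⁻¹' Z) +
            ∑' z, if z = y then N.step x y * s else 0 := by
            rw [tsum_ite_eq]; gcongr
        _ = ∑' z, (N.step x z * N.law z (Run.cons x ⁻¹' Z) +
            if z = y then N.step x y * s else 0) := ENNReal.tsum_add.symm
        _ ≤ ∑' z, N.step x z * s := by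
            refine ENNReal.tsum_le_tsum fun z => ?_
            split_ifs with hz
            · subst hz; simp [h0]
            · rw [add_zero]
              gcongr
              exact (measure_mono (hcons x)).trans (hle z)
        _ = s := by rw [ENNReal.tsum_mul_right, PMF.tsum_coe, one_mul]
    -- The bound from `A` spreads to all starting states by induction on a bound for the time of the
    -- first visit to `A`.
    have hn : ∀ n x, N.law x (Z ∩ {ω | ∃ k ≤ n, ω k ∈ A}) ≤ s - q * s := by
      intro n
      have hmE : ∀ n, MeasurableSet {ω : Run V | ∃ k ≤ n, ω k ∈ A} := by
        intro n
        have : {ω : Run V | ∃ k ≤ n, ω k ∈ A} = ⋃ k : ℕ, ⋃ _ : k ≤ n, {ω : Run V | ω k ∈ A} := by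
          ext ω; simp
        rw [this]
        exact MeasurableSet.iUnion fun k => MeasurableSet.iUnion fun _ =>
          Run.measurableSet_coord k A
      induction n with
      | zero =>
        intro x
        by_cases hx : x ∈ A
        · exact (measure_mono Set.inter_subset_left).trans (hA x hx)
        · refine le_of_eq_of_le (measure_mono_null ?_ (ae_iff.1 (N.law_start x))) zero_le
          rintro ω ⟨-, k, hk, h1⟩ hω
          obtain rfl : k = 0 := by omega
          exact hx (hω ▸ h1)
      | succ n ihn =>
        intro x
        by_cases hx : x ∈ A
        · exact (measure_mono Set.inter_subset_left).trans (hA x hx)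
        · rw [N.law_apply x ((hmZ 0).inter (hmE _))]
          calc ∑' y, N.step x y * N.law y (Run.cons x ⁻¹' (Z ∩ {ω | ∃ k ≤ n + 1, ω k ∈ A}))
              ≤ ∑' y, N.step x y * (s - q * s) := by
                refine ENNReal.tsum_le_tsum fun y => ?_
                gcongr
                refine le_trans (measure_mono ?_) (ihn y)
                rintro ω ⟨h1, k, hk, h2⟩
                refine ⟨hcons x h1, ?_⟩
                cases k with
                | zero => exact absurd h2 hx
                | succ k => exact ⟨k, by omega, h2⟩
            _ = s - q * s := by rw [ENNReal.tsum_mul_right, PMF.tsum_coe, one_mul]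
    have hall : ∀ x, N.law x Z ≤ s - q * s := by
      intro x
      have hU : Z = ⋃ n : ℕ, Z ∩ {ω | ∃ k ≤ n, ω k ∈ A} := by
        rw [← Set.inter_iUnion]
        refine (Set.inter_eq_left.2 fun ω hω => ?_).symm
        obtain ⟨n, hn⟩ := hω.1.exists
        exact Set.mem_iUnion.2 ⟨n, n, le_rfl, hn⟩
      rw [hU, Monotone.measure_iUnion]
      · exact iSup_le fun n => hn n x
      · rintro a b hab ω ⟨h1, k, hk, h2⟩
        exact ⟨h1, k, hk.trans hab, h2⟩
    have hs2 : s ≤ s - q * s := iSup_le hall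
    have hsz : s = 0 := by
      by_contra hne
      by_cases hAe : A.Nonempty
      · obtain ⟨x, hx⟩ := hAe
        have : s - q * s < s := ENNReal.sub_lt_self (hs1.trans_lt ENNReal.one_lt_top).ne hne
          (mul_ne_zero hq hne)
        exact absurd hs2 (not_le.2 this)
      · refine hne ?_
        rw [hs]
        simp only [ENNReal.iSup_eq_zero]
        intro x
        have : Z = ∅ := by
          ext ω
          simp [hZ, Set.not_nonempty_iff_eq_empty.1 hAe]
        simp [this]
    exact le_antisymm ((hle x).trans_eq hsz) zero_le

/-- If from every state of `A` the chain moves to `Y` with probability at least `q > 0`, then a run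
that visits `A` infinitely often almost surely moves from `A` to `Y` infinitely often. -/
theorem MarkovChain.law_ae_frequently {V : Type*} [Countable V] (N : MarkovChain V)
    {A Y : Set V} {q : ℝ≥0∞} (hq : q ≠ 0) (h : ∀ x ∈ A, ∃ y ∈ Y, q ≤ N.step x y) (x : V) :
    ∀ᵐ ω ∂N.law x, (∃ᶠ n in atTop, ω n ∈ A) →
      ∃ᶠ n in atTop, ω n ∈ A ∧ ω (n + 1) ∈ Y := by
  have h1 : ∀ m : ℕ, ∀ᵐ ω ∂N.law x, ¬ ((∃ᶠ n in atTop, ω n ∈ A) ∧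
      ∀ n, m ≤ n → ¬ (ω n ∈ A ∧ ω (n + 1) ∈ Y)) := by
    intro m
    rw [ae_iff]
    simpa using N.law_frequently_avoid hq h m x
  filter_upwards [ae_all_iff.2 h1] with ω hω hF
  rw [frequently_atTop]
  intro a
  by_contra hc
  push Not at hc
  exact hω a ⟨hF, fun n hn hA => hc n hn hA.1 hA.2⟩

/-- The set of states that a sequence visits infinitely often. -/
def limitSet {V : Type*} (σ : ℕ → V) : Set V := {x | ∃ᶠ n in atTop, σ n = x}

theorem Run.measurableSet_limitSet {V : Type*} [Finite V] (p : Set V → Prop) :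
    MeasurableSet {ω : Run V | p (limitSet ω)} := by
  have : {ω : Run V | p (limitSet ω)} =
      ⋃ B : {B : Set V // p B}, ⋂ x : V, {ω : Run V | x ∈ limitSet ω ↔ x ∈ B.1} := by
    ext ω
    simp only [Set.mem_ofPred_eq, Set.mem_iUnion, Set.mem_iInter]
    constructor
    · intro h
      exact ⟨⟨_, h⟩, fun x => Iff.rfl⟩
    · rintro ⟨⟨B, hB⟩, h⟩
      rwa [Set.ext h]
  rw [this]
  refine MeasurableSet.iUnion fun B => MeasurableSet.iInter fun x => ?_
  have hm : MeasurableSet {ω : Run V | x ∈ limitSet ω} :=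
    Run.measurableSet_frequently fun a _ => a = x
  by_cases hx : x ∈ B.1
  · simpa [hx] using hm
  · simp only [hx, iff_false]
    exact hm.compl

theorem limitSet_cons {V : Type*} (x : V) (ω : Run V) : limitSet (Run.cons x ω) = limitSet ω := by
  ext y
  exact (frequently_atTop_succ_iff (p := fun n => Run.cons x ω n = y)).symm

theorem limitSet_nonempty {V : Type*} [Finite V] (σ : ℕ → V) : (limitSet σ).Nonempty := by
  by_contra h
  have h1 : ∀ x, ∀ᶠ n in atTop, σ n ≠ x := by
    intro x
    by_contra hx
    exact h ⟨x, hx⟩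
  obtain ⟨n, hn⟩ := (eventually_all.2 h1).exists
  exact hn _ rfl

theorem eventually_mem_limitSet {V : Type*} [Finite V] (σ : ℕ → V) :
    ∀ᶠ n in atTop, σ n ∈ limitSet σ := by
  have h1 : ∀ x, ∀ᶠ n in atTop, σ n = x → x ∈ limitSet σ := by
    intro x
    by_cases hx : x ∈ limitSet σ
    · exact Eventually.of_forall fun _ _ => hx
    · have : ∀ᶠ n in atTop, ¬ σ n = x := by
        by_contra h
        exact hx h
      filter_upwards [this] with n hn h
      exact absurd h hn
  filter_upwards [eventually_all.2 h1] with n hn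
  exact hn _ rfl

/-- Almost surely, a transition whose source is visited infinitely often is taken infinitely
often. -/
theorem MarkovChain.law_ae_recurrent {V : Type*} [Countable V] (N : MarkovChain V) (x : V) :
    ∀ᵐ ω : Run V ∂N.law x, ∀ u v, N.step u v ≠ 0 → u ∈ limitSet ω →
      ∃ᶠ n in atTop, ω n = u ∧ ω (n + 1) = v := by
  rw [ae_all_iff]; intro u
  rw [ae_all_iff]; intro v
  by_cases huv : N.step u v = 0
  · exact Eventually.of_forall fun ω h => absurd huv h
  · filter_upwards [N.law_ae_frequently (A := {u}) (Y := {v}) huv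
      (fun x hx => ⟨v, rfl, by rw [Set.mem_singleton_iff.1 hx]⟩) x] with ω hω _ hu
    exact hω hu

/-- A set of states that no transition of positive probability leaves. -/
def MarkovChain.Closed {V : Type*} (N : MarkovChain V) (K : Set V) : Prop :=
  ∀ u ∈ K, ∀ v, N.step u v ≠ 0 → v ∈ K

/-- The target of a transition that is taken infinitely often is itself visited infinitely often. -/
theorem MarkovChain.closed_limitSet {V : Type*} (N : MarkovChain V) {σ : ℕ → V}
    (h : ∀ u v, N.step u v ≠ 0 → u ∈ limitSet σ → ∃ᶠ n in atTop, σ n = u ∧ σ (n + 1) = v) :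
    N.Closed (limitSet σ) := fun u hu v huv =>
  frequently_atTop_succ_iff.1 ((h u v huv hu).mono fun _ hn => hn.2)

/-! ### Rabin acceptance in the product chain -/

/-- The automaton started in another state. -/
def DRA.restart {A Q : Type*} (D : DRA A Q) (q : Q) : DRA A Q := ⟨D.step, q, D.acc⟩

theorem DRA.restart_run_succ {A Q : Type*} (D : DRA A Q) (q : Q) (w : ℕ → A) (n : ℕ) :
    (D.restart q).run w (n + 1) = (D.restart (D.step q (w 0))).run (fun i => w (i + 1)) n := by
  induction n with
  | zero => rfl
  | succ n ih => rw [DRA.run, ih]; rfl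

/-- The run of the product chain over a run of the labelled Markov chain. -/
def LabelledMarkovChain.liftRun {S Ap Q : Type*} (M : LabelledMarkovChain S Ap)
    (D : DRA (Set Ap) Q) (q : Q) (ρ : Run S) : Run (S × Q) :=
  fun n => (ρ n, (D.restart q).run (fun i => M.label (ρ i)) (n + 1))

theorem LabelledMarkovChain.liftRun_cons {S Ap Q : Type*} (M : LabelledMarkovChain S Ap)
    (D : DRA (Set Ap) Q) (q : Q) (s : S) (ρ : Run S) :
    M.liftRun D q (Run.cons s ρ) =
      Run.cons (s, D.step q (M.label s)) (M.liftRun D (D.step q (M.label s)) ρ) := by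
  funext n
  cases n with
  | zero => rfl
  | succ n =>
    simp only [LabelledMarkovChain.liftRun, Run.cons_succ]
    rw [DRA.restart_run_succ]
    rfl

theorem LabelledMarkovChain.measurable_liftRun {S Ap Q : Type*} [Countable S] [Countable Q]
    (M : LabelledMarkovChain S Ap) (D : DRA (Set Ap) Q) (q : Q) : Measurable (M.liftRun D q) := by
  have h1 : ∀ n (q' : Q), MeasurableSet
      {ρ : Run S | (D.restart q).run (fun i => M.label (ρ i)) n = q'} := by
    intro n
    induction n with
    | zero => intro q'; exact MeasurableSet.const (q = q')
    | succ n ih =>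
      intro q'
      have : {ρ : Run S | (D.restart q).run (fun i => M.label (ρ i)) (n + 1) = q'} =
          ⋃ q'' : Q, {ρ : Run S | (D.restart q).run (fun i => M.label (ρ i)) n = q''} ∩
            {ρ : Run S | ρ n ∈ {s | D.step q'' (M.label s) = q'}} := by
        ext ρ
        simp [DRA.run, DRA.restart]
      rw [this]
      exact MeasurableSet.iUnion fun q'' => (ih q'').inter (Run.measurableSet_coord n _)
  refine Run.measurable_of_coord fun n A => ?_
  have : {ρ : Run S | M.liftRun D q ρ n ∈ A} =
      ⋃ q' : Q, {ρ : Run S | (D.restart q).run (fun i => M.label (ρ i)) (n + 1) = q'} ∩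
        {ρ : Run S | ρ n ∈ {s | (s, q') ∈ A}} := by
    ext ρ
    simp [LabelledMarkovChain.liftRun]
  rw [this]
  exact MeasurableSet.iUnion fun q' => (h1 _ q').inter (Run.measurableSet_coord n _)

theorem PMF.tsum_map_mul {α β : Type*} (p : PMF α) (f : α → β) (G : β → ℝ≥0∞) :
    ∑' b, p.map f b * G b = ∑' a, p a * G (f a) := by
  classical
  simp_rw [PMF.map_apply, ← ENNReal.tsum_mul_right]
  rw [ENNReal.tsum_comm]
  refine tsum_congr fun a => ?_
  rw [tsum_eq_single (f a)]
  · simp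
  · intro b hb
    simp [hb]

theorem LabelledMarkovChain.tsum_product_step {S Ap Q : Type*} (M : LabelledMarkovChain S Ap)
    (D : DRA (Set Ap) Q) (x : S × Q) (G : S × Q → ℝ≥0∞) :
    ∑' y, (M.product D).step x y * G y =
      ∑' t, M.step x.1 t * G (t, D.step x.2 (M.label t)) :=
  PMF.tsum_map_mul _ _ _

theorem LabelledMarkovChain.tsum_product_init {S Ap Q : Type*} (M : LabelledMarkovChain S Ap)
    (D : DRA (Set Ap) Q) (G : S × Q → ℝ≥0∞) :
    ∑' y, (M.product D).init y * G y =
      ∑' t, M.init t * G (t, D.step D.start (M.label t)) :=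
  PMF.tsum_map_mul _ _ _

theorem Run.cons_preimage_cyl_succ {V : Type*} (x : V) (n : ℕ) (g : ℕ → V) :
    Run.cons x ⁻¹' Run.cyl (n + 1) g = {_ω | g 0 = x} ∩ Run.cyl n (fun i => g (i + 1)) := by
  ext ω
  simp only [Run.cyl, Set.mem_preimage, Set.mem_ofPred_eq, Set.mem_inter_iff]
  constructor
  · intro h
    exact ⟨(h 0 (Nat.zero_le _)).symm, fun i hi => h (i + 1) (by omega)⟩
  · rintro ⟨h0, h⟩ i hi
    cases i with
    | zero => exact h0.symm
    | succ i => exact h i (by omega)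

/-- The automaton is deterministic, so a run of the product carries no more randomness than its
first component. The automaton state `q` is arbitrary because the induction on the cylinder length
moves it along. -/
theorem LabelledMarkovChain.map_liftRun_law {S Ap Q : Type*} [Countable S] [Countable Q]
    (M : LabelledMarkovChain S Ap) (D : DRA (Set Ap) Q) (q : Q) (s : S) :
    (M.law s).map (M.liftRun D q) = (M.product D).law (s, D.step q (M.label s)) := by
  have := Measure.isProbabilityMeasure_map (μ := M.law s) (M.measurable_liftRun D q).aemeasurable
  refine Run.measure_ext fun n => ?_
  clear this
  induction n generalizing q s with
  | zero =>
    classical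
    intro g
    rw [Measure.map_apply (M.measurable_liftRun D q) (Run.measurableSet_cyl _ _),
      MarkovChain.law_cyl]
    by_cases h : g 0 = (s, D.step q (M.label s))
    · have : ∀ᵐ ρ ∂M.law s, ρ ∈ M.liftRun D q ⁻¹' Run.cyl 0 g := by
        filter_upwards [M.law_start s] with ρ hρ i hi
        obtain rfl : i = 0 := by omega
        rw [h, ← hρ]; rfl
      rw [prob_compl_eq_zero_iff₀
        (((M.measurable_liftRun D q) (Run.measurableSet_cyl _ _)).nullMeasurableSet)
        |>.1 (ae_iff.1 this)]
      simp [h]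
    · simp only [h, if_false, zero_mul]
      refine measure_mono_null ?_ (ae_iff.1 (M.law_start s))
      intro ρ h1 hρ
      refine h ?_
      rw [← h1 0 le_rfl, ← hρ]; rfl
  | succ n ih =>
    intro g
    rw [Measure.map_apply (M.measurable_liftRun D q) (Run.measurableSet_cyl _ _),
      MarkovChain.law_apply _ _ ((M.measurable_liftRun D q) (Run.measurableSet_cyl _ _)),
      MarkovChain.law_apply _ _ (Run.measurableSet_cyl _ _)]
    rw [M.tsum_product_step]
    refine tsum_congr fun t => ?_
    congr 1
    rw [Run.cons_preimage_cyl_succ, ← Set.preimage_comp]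
    have : (M.liftRun D q ∘ Run.cons s) ⁻¹' Run.cyl (n + 1) g =
        {_ω | g 0 = (s, D.step q (M.label s))} ∩
        M.liftRun D (D.step q (M.label s)) ⁻¹' Run.cyl n (fun i => g (i + 1)) := by
      have h2 : M.liftRun D q ∘ Run.cons s = Run.cons (s, D.step q (M.label s)) ∘
          M.liftRun D (D.step q (M.label s)) := funext (M.liftRun_cons D q s)
      rw [h2, Set.preimage_comp, Run.cons_preimage_cyl_succ]
      rfl
    rw [this]
    by_cases h0 : g 0 = (s, D.step q (M.label s))
    · have := ih (D.step q (M.label s)) t fun i => g (i + 1)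
      rw [Measure.map_apply (M.measurable_liftRun D _) (Run.measurableSet_cyl _ _)] at this
      simpa [h0] using this
    · simp [h0]

/-- A product state already contains the automaton state after its own letter, hence the shift by
one, which does not affect what happens infinitely often. By finiteness, an automaton state recurs
exactly when some product state above it does. -/
theorem DRA.accepts_iff_good_limitSet {A Q S : Type*} [Finite S] [Finite Q] (D : DRA A Q)
    (w : ℕ → A) (σ : ℕ → S × Q) (h : ∀ n, (σ n).2 = D.run w (n + 1)) :
    D.Accepts w ↔ D.Good (limitSet σ) := by
  have key : ∀ q, (∃ᶠ n in atTop, D.run w n = q) ↔ ∃ x ∈ limitSet σ, x.2 = q := by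
    intro q
    rw [← frequently_atTop_succ_iff]
    constructor
    · intro hq
      by_contra hc
      push Not at hc
      refine hq ?_
      filter_upwards [eventually_mem_limitSet σ] with n hn h1
      exact hc _ hn (by rw [h, h1])
    · rintro ⟨x, hx, rfl⟩
      refine Frequently.mono hx fun n hn => ?_
      rw [← h, hn]
  constructor
  · rintro ⟨p, hp, hE, q, hq, hF⟩
    obtain ⟨x, hx, rfl⟩ := (key q).1 hF
    exact ⟨p, hp, fun y hy hyE => hE _ hyE ((key _).2 ⟨y, hy, rfl⟩), x, hx, hq⟩
  · rintro ⟨p, hp, hE, x, hx, hF⟩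
    exact ⟨p, hp, fun q hq hf => by
      obtain ⟨y, hy, rfl⟩ := (key q).1 hf
      exact hE y hy hq, x.2, hF, (key _).2 ⟨x, hx, rfl⟩⟩

/-- The probability that the run of the product chain from `x` has a good limit set. -/
noncomputable def LabelledMarkovChain.accProb {S Ap Q : Type*} (M : LabelledMarkovChain S Ap)
    (D : DRA (Set Ap) Q) (x : S × Q) : ℝ≥0∞ :=
  (M.product D).law x {ω | D.Good (limitSet ω)}

theorem LabelledMarkovChain.ofReal_prob {S Ap Q : Type*} [Finite S] [Finite Q]
    (M : LabelledMarkovChain S Ap) (φ : LTL Ap) (D : DRA (Set Ap) Q)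
    (hD : ∀ w : ℕ → Set Ap, D.Accepts w ↔ φ.Sat w) :
    ENNReal.ofReal (M.prob φ) = ∑' x, (M.product D).init x * M.accProb D x := by
  have hmG : MeasurableSet {ω : Run (S × Q) | D.Good (limitSet ω)} :=
    Run.measurableSet_limitSet _
  have hset : {ρ : Run S | φ.Sat (fun n => M.label (ρ n))} =
      M.liftRun D D.start ⁻¹' {ω | D.Good (limitSet ω)} := by
    ext ρ
    exact (hD _).symm.trans (D.accepts_iff_good_limitSet _ (M.liftRun D D.start ρ) fun n => rfl)
  rw [LabelledMarkovChain.prob, ofReal_measureReal, hset,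
    MarkovChain.runMeasure_apply _ (M.measurable_liftRun D _ hmG)]
  rw [M.tsum_product_init]
  refine tsum_congr fun s => ?_
  rw [← Measure.map_apply (M.measurable_liftRun D _) hmG, M.map_liftRun_law]
  rfl

theorem LabelledMarkovChain.accProb_le_one {S Ap Q : Type*} (M : LabelledMarkovChain S Ap)
    (D : DRA (Set Ap) Q) (x : S × Q) [Countable S] [Countable Q] : M.accProb D x ≤ 1 := prob_le_one

/-- Prepending a state does not change the limit set. -/
theorem LabelledMarkovChain.accProb_harmonic {S Ap Q : Type*} [Finite S] [Finite Q]
    (M : LabelledMarkovChain S Ap) (D : DRA (Set Ap) Q) (x : S × Q) :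
    M.accProb D x = ∑' y, (M.product D).step x y * M.accProb D y := by
  rw [LabelledMarkovChain.accProb, MarkovChain.law_apply _ _ (Run.measurableSet_limitSet _)]
  refine tsum_congr fun y => ?_
  congr 2
  ext ω
  simp [limitSet_cons]

theorem mem_of_closed_of_transGen {V : Type*} {N : MarkovChain V} {K : Set V} (hK : N.Closed K)
    {u v : V} (hu : u ∈ K) (h : Relation.TransGen (fun a b => N.step a b ≠ 0) u v) : v ∈ K := by
  induction h with
  | single h => exact hK _ hu _ h
  | tail _ h ih => exact hK _ ih _ h

/-- The limit set is almost surely closed; it is nonempty and contained in `K`, so strong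
connectedness makes it all of `K`, which is bad. -/
theorem LabelledMarkovChain.accProb_eq_zero {S Ap Q : Type*} [Finite S] [Finite Q]
    (M : LabelledMarkovChain S Ap) (D : DRA (Set Ap) Q) {K : Set (S × Q)}
    (hK : (M.product D).Closed K)
    (hc : ∀ u ∈ K, ∀ v ∈ K, Relation.TransGen (fun a b => (M.product D).step a b ≠ 0) u v)
    (hbad : ¬ D.Good K) {x : S × Q} (hx : x ∈ K) : M.accProb D x = 0 := by
  have : ∀ᵐ ω : Run (S × Q) ∂(M.product D).law x, ¬ D.Good (limitSet ω) := by
    filter_upwards [(M.product D).law_start x, (M.product D).law_ae_step x,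
      (M.product D).law_ae_recurrent x] with ω h0 h1 h2
    have hin : ∀ n, ω n ∈ K := by
      intro n
      induction n with
      | zero => rwa [h0]
      | succ n ih => exact hK _ ih _ (h1 n)
    have hcl := (M.product D).closed_limitSet h2
    have hsub : limitSet ω ⊆ K := fun y hy => by
      obtain ⟨n, hn⟩ := Frequently.exists hy
      exact hn ▸ hin n
    obtain ⟨y, hy⟩ := limitSet_nonempty ω
    have : limitSet ω = K := Set.Subset.antisymm hsub fun v hv =>
      mem_of_closed_of_transGen hcl hy (hc y (hsub hy) v hv)
    rwa [this]
  rw [ae_iff] at this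
  simpa [LabelledMarkovChain.accProb] using this

/-! ### Candidates of finite paths -/

section Candidates

variable {V : Type*}

theorem pathEdge_concat_iff {π : List V} {a b w : V} :
    pathEdge (π ++ [w]) a b ↔ pathEdge π a b ∨ (π.getLast? = some a ∧ b = w) := by
  unfold pathEdge
  rw [List.infix_concat_iff, or_comm]
  refine or_congr Iff.rfl ?_
  rw [List.suffix_concat_iff]
  constructor
  · rintro (h | ⟨t, h1, h2⟩)
    · simp at h
    · obtain ⟨rfl, rfl⟩ : t = [a] ∧ w = b := by
        match t, h1 with
        | [], h1 => simp at h1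
        | [c], h1 => simp at h1; simp [h1]
        | c :: d :: t, h1 => simp at h1
      obtain ⟨s, rfl⟩ := h2
      simp
  · rintro ⟨h1, rfl⟩
    right
    refine ⟨[a], rfl, ?_⟩
    obtain ⟨s, rfl⟩ := List.getLast?_eq_some_iff.1 h1
    exact ⟨s, rfl⟩

theorem pathEdge_mono {π π' : List V} (h : π <:+: π') {a b : V} (he : pathEdge π a b) :
    pathEdge π' a b := he.trans h

theorem pathEdge_mem_dropLast {π : List V} {a b : V} (h : pathEdge π a b) : a ∈ π.dropLast := by
  obtain ⟨s, t, rfl⟩ := h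
  rw [List.append_assoc, List.dropLast_append_of_ne_nil (by simp)]
  simp

theorem pathEdge_mem_left {π : List V} {a b : V} (h : pathEdge π a b) : a ∈ π :=
  List.mem_of_mem_dropLast (pathEdge_mem_dropLast h)

theorem IsBSCC.exists_edge {E : V → V → Prop} {B : Set V} (h : IsBSCC E B) {u : V} (hu : u ∈ B) :
    ∃ v ∈ B, E u v := by
  obtain ⟨v, hv, -⟩ := Relation.TransGen.head'_iff.1 (h.2.1 u hu u hu)
  exact ⟨v, h.2.2 u hu v hv, hv⟩

theorem forall_mem_of_closed_of_infix {π : List V} {B : Set V}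
    (hB : ∀ u ∈ B, ∀ v, pathEdge π u v → v ∈ B) (t : List V) (b : V) (hb : b ∈ B)
    (h : (b :: t) <:+: π) : ∀ x ∈ b :: t, x ∈ B := by
  induction t generalizing b with
  | nil => simpa using hb
  | cons c t ih =>
    have hc : c ∈ B := hB b hb c (List.IsInfix.trans ⟨[], t, rfl⟩ h)
    intro x hx
    rcases List.mem_cons.1 hx with rfl | hx
    · exact hb
    · exact ih c hc (List.IsInfix.trans ⟨[b], [], by simp⟩ h) x hx

/-- This removes the suffix from the definition. The part of `π` from the first visit to `B` on
serves as witness: it never leaves `B`, as no edge of the path does, and it meets all of `B`, as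
every state of `B` is the source of an edge. -/
theorem isCandidate_iff {π : List V} {B : Set V} :
    IsCandidate π B ↔ (∃ v, π.getLast? = some v ∧ v ∈ B) ∧ IsBSCC (pathEdge π) B := by
  classical
  constructor
  · rintro ⟨κ, ⟨s, rfl⟩, rfl, hB⟩
    have hκ : κ ≠ [] := by
      obtain ⟨v, hv⟩ := hB.1
      exact List.ne_nil_of_mem hv
    refine ⟨⟨κ.getLast hκ, ?_, List.getLast_mem hκ⟩, hB⟩
    rw [List.getLast?_append_of_ne_nil _ hκ, List.getLast?_eq_some_getLast]
  · rintro ⟨-, hB⟩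
    have hsuf : π.dropWhile (fun x => decide (x ∉ B)) <:+ π := List.dropWhile_suffix _
    refine ⟨_, hsuf, ?_, hB⟩
    ext u
    constructor
    · intro hu
      obtain ⟨v, -, huv⟩ := hB.exists_edge hu
      have hmem := pathEdge_mem_left huv
      rw [← List.takeWhile_append_dropWhile (p := fun x => decide (x ∉ B)) (l := π)] at hmem
      rcases List.mem_append.1 hmem with h | h
      · have := List.mem_takeWhile_imp h
        simp [hu] at this
      · exact h
    · intro hu
      cases hκ : π.dropWhile (fun x => decide (x ∉ B)) with
      | nil =>
        have hu' : u ∈ ([] : List V) := by rw [← hκ]; exact hu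
        simp at hu'
      | cons b t =>
        have hb : b ∈ B := by
          have hne : π.dropWhile (fun x => decide (x ∉ B)) ≠ [] := by rw [hκ]; simp
          have h1 := List.head_dropWhile_not (fun x => decide (x ∉ B)) (l := π) hne
          have h2 : (π.dropWhile (fun x => decide (x ∉ B))).head hne = b := by
            simp only [hκ, List.head_cons]
          rw [h2] at h1
          simpa using h1
        rw [hκ] at hsuf
        have hu' : u ∈ b :: t := by rw [← hκ]; exact hu
        exact forall_mem_of_closed_of_infix hB.2.2 t b hb hsuf.isInfix u hu'

theorem candidate_eq_some_iff {π : List V} {B : Set V} :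
    candidate π = some B ↔ IsCandidate π B := by
  unfold candidate
  constructor
  · intro h
    split_ifs at h with hB
    rw [← Option.some.inj h]
    exact hB.choose_spec
  · intro h
    have hB : ∃ B, IsCandidate π B := ⟨B, h⟩
    rw [dif_pos hB, hB.choose_spec.unique h]

theorem candidate_nil : candidate ([] : List V) = none := by
  cases h : candidate ([] : List V) with
  | none => rfl
  | some B =>
    obtain ⟨⟨v, hv, -⟩, -⟩ := isCandidate_iff.1 (candidate_eq_some_iff.1 h)
    simp at hv

theorem IsCandidate.concat {π : List V} {K : Set V} (h : IsCandidate π K) {w : V} (hw : w ∈ K) :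
    IsCandidate (π ++ [w]) K := by
  obtain ⟨-, h1, h2, h3⟩ := isCandidate_iff.1 h
  refine isCandidate_iff.2 ⟨⟨w, by simp, hw⟩, h1, fun u hu v hv => ?_, fun u hu v huv => ?_⟩
  · exact Relation.TransGen.mono (fun a b hab => pathEdge_concat_iff.2 (Or.inl hab)) _ _ (h2 u hu v hv)
  · rcases pathEdge_concat_iff.1 huv with h | ⟨-, rfl⟩
    · exact h3 u hu v h
    · exact hw

/-- The edge from the last state of `π` to `w` belongs to the longer path, whose bottom component
`K` it cannot leave. -/
theorem IsCandidate.mem_of_isCandidate_append {π τ : List V} {K : Set V} {w : V}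
    (h : IsCandidate π K) (h' : IsCandidate (π ++ [w] ++ τ) K) : w ∈ K := by
  obtain ⟨⟨v, hv, hvK⟩, -⟩ := isCandidate_iff.1 h
  refine (isCandidate_iff.1 h').2.2.2 v hvK w ?_
  exact pathEdge_mono (List.prefix_append _ _).isInfix (pathEdge_concat_iff.2 (Or.inr ⟨hv, rfl⟩))

/-- Once a candidate is left, it does not come back. -/
theorem IsCandidate.between {π τ τ' : List V} {K : Set V} (h : IsCandidate π K)
    (h' : IsCandidate (π ++ τ ++ τ') K) : IsCandidate (π ++ τ) K := by
  induction τ using List.reverseRecOn generalizing τ' with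
  | nil => simpa using h
  | append_singleton τ w ih =>
    have h1 : IsCandidate (π ++ τ ++ ([w] ++ τ')) K := by simpa using h'
    have h2 := ih h1
    have h3 : IsCandidate (π ++ τ ++ [w] ++ τ') K := by simpa using h'
    rw [← List.append_assoc]
    exact h2.concat (h2.mem_of_isCandidate_append h3)

theorem IsCandidate.between_of_isPrefix {π₁ π₂ π₃ : List V} {K : Set V} (h : IsCandidate π₁ K)
    (h' : IsCandidate π₃ K) (h12 : π₁ <+: π₂) (h23 : π₂ <+: π₃) : IsCandidate π₂ K := by
  obtain ⟨τ, rfl⟩ := h12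
  obtain ⟨τ', rfl⟩ := h23
  exact h.between h'

theorem isCandidate_concat_iff {π : List V} {K : Set V} {w : V} (h : IsCandidate π K) :
    IsCandidate (π ++ [w]) K ↔ w ∈ K :=
  ⟨fun h' => h.mem_of_isCandidate_append (τ := []) (by simpa using h'), h.concat⟩

/-! ### The candidate counter -/

/-- The pair `(C, i)` after the path has been read. -/
noncomputable def candidateState (π : List V) : Option (Set V) × ℕ :=
  π.inits.foldl updateCandidate (none, 0)

theorem candidateState_nil : candidateState ([] : List V) = (none, 0) := by
  simp [candidateState, updateCandidate, candidate_nil]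

theorem candidateState_concat (π : List V) (w : V) :
    candidateState (π ++ [w]) = updateCandidate (candidateState π) (π ++ [w]) := by
  unfold candidateState
  rw [List.inits_append, List.foldl_append]
  simp

theorem candidateState_fst_of_isCandidate {π : List V} {K : Set V} (h : IsCandidate π K) :
    (candidateState π).1 = some K := by
  have hK := candidate_eq_some_iff.2 h
  cases π using List.reverseRecOn with
  | nil => simp [candidate_nil] at hK
  | append_singleton π w =>
    rw [candidateState_concat]
    unfold updateCandidate
    split_ifs with hc
    · exact hK
    · by_contra hne
      exact hc ⟨by simp [hK], fun h' => hne (by rw [← h', hK])⟩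

theorem exists_prefix_of_candidateState_fst {π : List V} {K : Set V}
    (h : (candidateState π).1 = some K) : ∃ π', π' <+: π ∧ IsCandidate π' K := by
  induction π using List.reverseRecOn with
  | nil => simp [candidateState_nil] at h
  | append_singleton π w ih =>
    rw [candidateState_concat] at h
    unfold updateCandidate at h
    split_ifs at h with hc
    · exact ⟨_, List.prefix_refl _, candidate_eq_some_iff.1 h⟩
    · obtain ⟨π', h1, h2⟩ := ih h
      exact ⟨π', h1.trans (List.prefix_append _ _), h2⟩

theorem candidateIndex_nil : candidateIndex ([] : List V) = 0 :=
  congrArg Prod.snd candidateState_nil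

theorem candidateIndex_concat_of_none {π : List V} {w : V} (h : candidate (π ++ [w]) = none) :
    candidateIndex (π ++ [w]) = candidateIndex π := by
  change (candidateState (π ++ [w])).2 = (candidateState π).2
  rw [candidateState_concat, updateCandidate, if_neg (by simp [h])]

theorem candidateIndex_concat_of_mem {π : List V} {K : Set V} {w : V} (h : IsCandidate π K)
    (hw : w ∈ K) : candidateIndex (π ++ [w]) = candidateIndex π := by
  change (candidateState (π ++ [w])).2 = (candidateState π).2
  rw [candidateState_concat, updateCandidate, if_neg]
  rw [candidateState_fst_of_isCandidate h, candidate_eq_some_iff.2 (h.concat hw)]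
  simp

/-- The stored candidate `C` may be older than the candidate of `π`, which can be undefined. If `C`
were `K`, some prefix of `π` would have candidate `K`, and then so would `π`, since a candidate that
is left never returns. -/
theorem candidateIndex_concat_of_new {π : List V} {K : Set V} {w : V}
    (h : IsCandidate (π ++ [w]) K) (hπ : ¬ IsCandidate π K) :
    candidateIndex (π ++ [w]) = candidateIndex π + 1 := by
  change (candidateState (π ++ [w])).2 = (candidateState π).2 + 1
  rw [candidateState_concat, updateCandidate, if_pos]
  rw [candidate_eq_some_iff.2 h]
  refine ⟨by simp, fun hc => ?_⟩
  obtain ⟨π', h1, h2⟩ := exists_prefix_of_candidateState_fst hc.symm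
  exact hπ (h2.between_of_isPrefix h h1 (List.prefix_append _ _))

/-! ### The strength -/

/-- The part of the path from the birth of its candidate on. -/
noncomputable def candidateVisits (π : List V) : List V :=
  π.drop (sInf {n | candidate (π.take (n + 1)) = candidate π})

theorem candidateVisits_concat_of_mem {π : List V} {K : Set V} {w : V} (h : IsCandidate π K)
    (hw : w ∈ K) : candidateVisits (π ++ [w]) = candidateVisits π ++ [w] := by
  have hK := candidate_eq_some_iff.2 h
  have hK' := candidate_eq_some_iff.2 (h.concat hw)
  have hπ : π ≠ [] := by rintro rfl; simp [candidate_nil] at hK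
  have hlen : 0 < π.length := List.length_pos_iff.2 hπ
  unfold candidateVisits
  rw [hK, hK']
  set T := {n | candidate (π.take (n + 1)) = some K}
  have hlast : π.length - 1 ∈ T := by
    change candidate (π.take (π.length - 1 + 1)) = some K
    rw [Nat.sub_add_cancel hlen, List.take_length, hK]
  have ha : sInf T ∈ T := Nat.sInf_mem ⟨_, hlast⟩
  have hle : sInf T ≤ π.length - 1 := Nat.sInf_le hlast
  have htake : ∀ n, n + 1 ≤ π.length → (π ++ [w]).take (n + 1) = π.take (n + 1) := fun n hn =>
    List.take_append_of_le_length hn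
  have hinf : sInf {n | candidate ((π ++ [w]).take (n + 1)) = some K} = sInf T := by
    apply le_antisymm
    · apply Nat.sInf_le
      change candidate ((π ++ [w]).take (sInf T + 1)) = some K
      rw [htake _ (by omega)]
      exact ha
    · apply le_csInf
      · refine ⟨sInf T, ?_⟩
        change candidate ((π ++ [w]).take (sInf T + 1)) = some K
        rw [htake _ (by omega)]
        exact ha
      · intro b hb
        by_contra hlt
        have hb' : candidate ((π ++ [w]).take (b + 1)) = some K := hb
        rw [htake b (by omega)] at hb'
        exact hlt (Nat.sInf_le hb')
  rw [hinf, List.drop_append_of_le_length (by omega)]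

/-- By `IsCandidate.between_of_isPrefix`, no proper prefix has candidate `K`, so the candidate is
born at the last position. -/
theorem candidateVisits_concat_of_new {π : List V} {K : Set V} {w : V}
    (h : IsCandidate (π ++ [w]) K) (hπ : ¬ IsCandidate π K) :
    candidateVisits (π ++ [w]) = [w] := by
  unfold candidateVisits
  rw [candidate_eq_some_iff.2 h]
  have hmem : π.length ∈ {n | candidate ((π ++ [w]).take (n + 1)) = some K} := by
    change candidate ((π ++ [w]).take (π.length + 1)) = some K
    rw [List.take_of_length_le (by simp), candidate_eq_some_iff.2 h]
  have hinf : sInf {n | candidate ((π ++ [w]).take (n + 1)) = some K} = π.length := by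
    apply le_antisymm (Nat.sInf_le hmem)
    apply le_csInf ⟨_, hmem⟩
    intro b hb
    by_contra hlt
    have hb' : candidate ((π ++ [w]).take (b + 1)) = some K := hb
    rw [List.take_append_of_le_length (by omega)] at hb'
    exact hπ ((candidate_eq_some_iff.1 hb').between_of_isPrefix h (List.take_prefix _ _)
      (List.prefix_append _ _))
  rw [hinf]
  simp

open Classical in
theorem strength_eq {π : List V} {K : Set V} (h : IsCandidate π K) :
    strength π = sSup {k | (∀ v ∈ K, k ≤ (candidateVisits π).count v) ∧
      ∀ v ∈ (candidateVisits π).getLast?, k + 1 ≤ (candidateVisits π).count v} := by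
  unfold strength
  split
  · next h' => rw [candidate_eq_some_iff.2 h] at h'; simp at h'
  · next B h' =>
    obtain rfl : B = K := (candidate_eq_some_iff.1 h').unique h
    rfl

open Classical in
theorem bddAbove_strength {π : List V} {K : Set V} (h : IsCandidate π K) :
    BddAbove {k | (∀ v ∈ K, k ≤ (candidateVisits π).count v) ∧
      ∀ v ∈ (candidateVisits π).getLast?, k + 1 ≤ (candidateVisits π).count v} := by
  obtain ⟨v, hv⟩ := (isCandidate_iff.1 h).2.1
  exact ⟨_, fun k hk => hk.1 v hv⟩

-- The supremum is attained: the set contains `0`, because the last state occurs at least once, and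
-- it is bounded by the number of visits to any state of `K`.
open Classical in
theorem count_of_le_strength {π : List V} {K : Set V} (h : IsCandidate π K) {k : ℕ}
    (hk : k ≤ strength π) : (∀ v ∈ K, k ≤ (candidateVisits π).count v) ∧
      ∀ v ∈ (candidateVisits π).getLast?, k + 1 ≤ (candidateVisits π).count v := by
  rw [strength_eq h] at hk
  have hne : {k | (∀ v ∈ K, k ≤ (candidateVisits π).count v) ∧
      ∀ v ∈ (candidateVisits π).getLast?, k + 1 ≤ (candidateVisits π).count v}.Nonempty :=
    ⟨0, fun v _ => Nat.zero_le _, fun v hv => by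
      rw [zero_add]
      exact List.count_pos_iff.2 (List.mem_of_mem_getLast? hv)⟩
  obtain ⟨h1, h2⟩ := Nat.sSup_mem hne (bddAbove_strength h)
  exact ⟨fun v hv => hk.trans (h1 v hv), fun v hv => (Nat.succ_le_succ hk).trans (h2 v hv)⟩

-- One visit more than necessary is required of every state, which makes a case distinction for the
-- last state superfluous.
open Classical in
theorem le_strength_of_count {π : List V} {K : Set V} (h : IsCandidate π K) {k : ℕ}
    (hk : ∀ v ∈ K, k + 1 ≤ (candidateVisits π).count v) : k ≤ strength π := by
  rw [strength_eq h]
  refine le_csSup (bddAbove_strength h) ⟨fun v hv => (Nat.le_succ k).trans (hk v hv), ?_⟩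
  intro v hv
  refine hk v ?_
  obtain ⟨⟨u, hu, huK⟩, -⟩ := isCandidate_iff.1 h
  have : π.getLast? = some v := by
    obtain ⟨s, hs⟩ := List.getLast?_eq_some_iff.1 hv
    have h1 : π = π.take (sInf {n | candidate (π.take (n + 1)) = candidate π}) ++ (s ++ [v]) := by
      rw [← hs]; exact (List.take_append_drop _ _).symm
    rw [h1]
    simp
  rw [hu] at this
  rwa [← Option.some.inj this]

/-! ### Candidates along an infinite path -/

theorem pathEdge_map_range {σ : ℕ → V} {n k : ℕ} (h : n + 1 < k) :
    pathEdge ((List.range k).map σ) (σ n) (σ (n + 1)) := by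
  obtain ⟨d, rfl⟩ := Nat.exists_eq_add_of_lt h
  have : List.range (n + 1 + d + 1) =
      List.range n ++ [n, n + 1] ++ (List.range d).map (fun i => n + 2 + i) := by
    rw [show n + 1 + d + 1 = (n + 2) + d by omega, List.range_add, List.range_succ, List.range_succ]
    simp
  rw [this]
  exact ⟨(List.range n).map σ, ((List.range d).map (fun i => n + 2 + i)).map σ, by simp⟩

theorem pathEdge_map_range_iff {σ : ℕ → V} {k : ℕ} {u v : V} :
    pathEdge ((List.range k).map σ) u v ↔ ∃ n, n + 1 < k ∧ u = σ n ∧ v = σ (n + 1) := by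
  constructor
  · intro h
    induction k with
    | zero => exact absurd (pathEdge_mem_left h) (by simp)
    | succ k ih =>
      rw [List.range_succ, List.map_append, List.map_singleton, pathEdge_concat_iff] at h
      rcases h with h | ⟨h1, h2⟩
      · obtain ⟨n, hn, h3⟩ := ih h
        exact ⟨n, by omega, h3⟩
      · cases k with
        | zero => simp at h1
        | succ k =>
          rw [List.range_succ] at h1
          simp at h1
          exact ⟨k, by omega, h1.symm, h2⟩
  · rintro ⟨n, hn, rfl, rfl⟩
    exact pathEdge_map_range hn

theorem transGen_pathEdge_map_range {σ : ℕ → V} {n m k : ℕ} (hnm : n < m) (hmk : m < k) :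
    Relation.TransGen (pathEdge ((List.range k).map σ)) (σ n) (σ m) := by
  induction m, hnm using Nat.le_induction with
  | base => exact Relation.TransGen.single (pathEdge_map_range hmk)
  | succ m hm ih => exact (ih (by omega)).tail (pathEdge_map_range hmk)

/-- Between any two recurrent states the sequence has a walk, which the path contains from some time
on; there are finitely many pairs. Closedness prevents old edges of the path from leaving the limit
set. -/
theorem eventually_isCandidate_limitSet [Finite V] {N : MarkovChain V} {σ : ℕ → V}
    (hstep : ∀ n, N.step (σ n) (σ (n + 1)) ≠ 0) (hcl : N.Closed (limitSet σ)) :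
    ∀ᶠ k in atTop, IsCandidate ((List.range k).map σ) (limitSet σ) := by
  have h1 : ∀ᶠ k in atTop, ∀ u v, u ∈ limitSet σ → v ∈ limitSet σ →
      Relation.TransGen (pathEdge ((List.range k).map σ)) u v := by
    refine eventually_all.2 fun u => eventually_all.2 fun v => ?_
    by_cases hu : u ∈ limitSet σ
    · by_cases hv : v ∈ limitSet σ
      · obtain ⟨n, rfl⟩ := Frequently.exists hu
        obtain ⟨m, hm, rfl⟩ := frequently_atTop.1 hv (n + 1)
        filter_upwards [eventually_gt_atTop m] with k hk _ _
        exact transGen_pathEdge_map_range hm hk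
      · exact Eventually.of_forall fun _ _ h => absurd h hv
    · exact Eventually.of_forall fun _ h => absurd h hu
  have h2 : ∀ᶠ k in atTop, σ (k - 1) ∈ limitSet σ :=
    (tendsto_sub_atTop_nat 1).eventually (eventually_mem_limitSet σ)
  filter_upwards [h1, h2, eventually_ge_atTop 1] with k hk1 hk2 hk3
  refine isCandidate_iff.2 ⟨⟨_, ?_, hk2⟩, limitSet_nonempty σ, fun u hu v hv => hk1 u v hu hv, ?_⟩
  · obtain ⟨k, rfl⟩ := Nat.exists_eq_add_of_le' hk3
    simp [List.range_succ]
  · intro u hu v huv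
    obtain ⟨n, -, rfl, rfl⟩ := pathEdge_map_range_iff.1 huv
    exact hcl _ hu _ (hstep n)

open Classical in
theorem eventually_le_count_drop {σ : ℕ → V} {v : V} (hv : v ∈ limitSet σ) (a m : ℕ) :
    ∀ᶠ k in atTop, m ≤ (((List.range k).map σ).drop a).count v := by
  have hmono : ∀ k k', k ≤ k' → (((List.range k).map σ).drop a).count v ≤
      (((List.range k').map σ).drop a).count v := by
    intro k k' h
    obtain ⟨d, rfl⟩ := Nat.exists_eq_add_of_le h
    refine List.Sublist.count_le _ (List.Sublist.drop ?_ _)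
    rw [List.range_add, List.map_append]
    exact List.sublist_append_left _ _
  induction m with
  | zero => exact Eventually.of_forall fun _ => Nat.zero_le _
  | succ m ih =>
    obtain ⟨k, hk⟩ := ih.exists
    obtain ⟨j, hj, hjv⟩ := frequently_atTop.1 hv (max k a)
    filter_upwards [eventually_ge_atTop (j + 1)] with k' hk'
    refine le_trans ?_ (hmono _ _ hk')
    rw [List.range_succ, List.map_append, List.drop_append_of_le_length (by
      simpa using le_trans (le_max_right _ _) hj), List.count_append]
    have := hmono k j (le_trans (le_max_left _ _) hj)
    simp [hjv]
    omega

/-- Once the candidate is permanently the limit set, its index is frozen while every state of it is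
visited again and again. One `i` for all `m` is essential, since the reset threshold depends on the
index. -/
theorem exists_strength_ge [Finite V] {N : MarkovChain V} {σ : ℕ → V}
    (hstep : ∀ n, N.step (σ n) (σ (n + 1)) ≠ 0) (hcl : N.Closed (limitSet σ)) :
    ∃ i, ∀ m, ∃ k, IsCandidate ((List.range k).map σ) (limitSet σ) ∧
      candidateIndex ((List.range k).map σ) = i ∧ m ≤ strength ((List.range k).map σ) := by
  classical
  obtain ⟨a, ha⟩ := eventually_atTop.1 (eventually_isCandidate_limitSet hstep hcl)
  have hmem : ∀ k, a ≤ k → σ k ∈ limitSet σ := by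
    intro k hk
    have h1 := ha (k + 1) (by omega)
    rw [List.range_succ, List.map_append, List.map_singleton,
      isCandidate_concat_iff (ha k hk)] at h1
    exact h1
  refine ⟨candidateIndex ((List.range a).map σ), fun m => ?_⟩
  have hidx : ∀ k, a ≤ k →
      candidateIndex ((List.range k).map σ) = candidateIndex ((List.range a).map σ) := by
    intro k hk
    induction k, hk using Nat.le_induction with
    | base => rfl
    | succ k hk ih =>
      rw [List.range_succ, List.map_append, List.map_singleton,
        candidateIndex_concat_of_mem (ha k hk) (hmem k hk), ih]
  have hvis : ∀ k, a ≤ k → ∀ v, (((List.range k).map σ).drop a).count v ≤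
      (candidateVisits ((List.range k).map σ)).count v := by
    intro k hk v
    refine List.Sublist.count_le _ ?_
    unfold candidateVisits
    -- The candidate is born at position `a` or earlier: the prefix of length `min (a + 1) k` is at
    -- least as long as `a` and so already has it.
    refine List.drop_sublist_drop_left _ (Nat.sInf_le ?_)
    change candidate _ = candidate _
    rw [candidate_eq_some_iff.2 (ha k hk), candidate_eq_some_iff, ← List.map_take,
      List.take_range]
    refine ha _ ?_
    rcases Nat.eq_or_lt_of_le hk with rfl | h
    · simp
    · simp; omega
  have h1 : ∀ᶠ k in atTop, ∀ v, v ∈ limitSet σ →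
      m + 1 ≤ (((List.range k).map σ).drop a).count v := by
    refine eventually_all.2 fun v => ?_
    by_cases hv : v ∈ limitSet σ
    · filter_upwards [eventually_le_count_drop hv a (m + 1)] with k hk _
      exact hk
    · exact Eventually.of_forall fun _ h => absurd h hv
  obtain ⟨k, hk, hk'⟩ := (h1.and (eventually_ge_atTop a)).exists
  exact ⟨k, ha k hk', hidx k hk', le_strength_of_count (ha k hk') fun v hv =>
    (hk v hv).trans (hvis k hk' v)⟩

end Candidates

/-! ### Stopping a chain when a condition on its history holds -/

section Potential

variable {V : Type*}

open Classical in
/-- The probability that, starting with the history `π`, the condition `C` holds neither of `π` nor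
of the next `n - 1` histories. -/
noncomputable def MarkovChain.stayProb (N : MarkovChain V) (C : List V → Prop) :
    ℕ → List V → ℝ≥0∞
  | 0, _ => 1
  | n + 1, π => if C π then 0 else ∑' v, N.nextState π v * N.stayProb C n (π ++ [v])

theorem MarkovChain.nextState_of_getLast? (N : MarkovChain V) {π : List V} {v : V}
    (h : π.getLast? = some v) : N.nextState π = N.step v := by
  simp [MarkovChain.nextState, h]

/-- All edges of the path have positive probability. -/
def MarkovChain.IsPath (N : MarkovChain V) (π : List V) : Prop :=
  ∀ a b, pathEdge π a b → N.step a b ≠ 0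

theorem MarkovChain.isPath_nil (N : MarkovChain V) : N.IsPath [] := fun _ _ h =>
  absurd (pathEdge_mem_left h) (by simp)

theorem MarkovChain.IsPath.concat {N : MarkovChain V} {π : List V} (h : N.IsPath π) {w : V}
    (hw : N.nextState π w ≠ 0) : N.IsPath (π ++ [w]) := by
  intro a b hab
  rcases pathEdge_concat_iff.1 hab with h1 | ⟨h1, rfl⟩
  · exact h a b h1
  · rwa [N.nextState_of_getLast? h1] at hw

/-- The expected value of `h` at the current state, the expected initial state for the empty
path. -/
noncomputable def MarkovChain.lastValue (N : MarkovChain V) (h : V → ℝ≥0∞) (π : List V) : ℝ≥0∞ :=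
  ∑' w, N.nextState π w * h w

theorem MarkovChain.lastValue_of_getLast? {N : MarkovChain V} {h : V → ℝ≥0∞}
    (hh : ∀ v, h v = ∑' w, N.step v w * h w) {π : List V} {v : V} (hv : π.getLast? = some v) :
    N.lastValue h π = h v := by
  rw [MarkovChain.lastValue, N.nextState_of_getLast? hv, ← hh]

theorem MarkovChain.lastValue_concat {N : MarkovChain V} {h : V → ℝ≥0∞}
    (hh : ∀ v, h v = ∑' w, N.step v w * h w) (π : List V) (w : V) :
    N.lastValue h (π ++ [w]) = h w := MarkovChain.lastValue_of_getLast? hh (by simp)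

/-- A set of states is strongly connected in the graph of the chain. -/
def MarkovChain.StronglyConnected (N : MarkovChain V) (K : Set V) : Prop :=
  ∀ u ∈ K, ∀ v ∈ K, Relation.TransGen (fun a b => N.step a b ≠ 0) u v

theorem MarkovChain.IsPath.stronglyConnected {N : MarkovChain V} {π : List V} (h : N.IsPath π)
    {K : Set V} (hK : IsCandidate π K) : N.StronglyConnected K := fun u hu v hv =>
  Relation.TransGen.mono h _ _ ((isCandidate_iff.1 hK).2.2.1 u hu v hv)

/-- From some state of a strongly connected set that is not closed, a transition leaves the set
without decreasing a given harmonic function. -/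
theorem exists_exit_of_harmonic [Finite V] {N : MarkovChain V} {h : V → ℝ≥0∞}
    (hh : ∀ v, h v = ∑' w, N.step v w * h w) (hfin : ∀ v, h v ≠ ∞) {K : Set V}
    (hne : K.Nonempty) (hsc : N.StronglyConnected K) (hcl : ¬ N.Closed K) :
    ∃ z ∈ K, ∃ t, t ∉ K ∧ N.step z t ≠ 0 ∧ h z ≤ h t := by
  by_contra hc
  push Not at hc
  obtain ⟨z₀, hz₀, hmax⟩ := Set.exists_max_image K h K.toFinite hne
  -- Maximum principle: at a maximizer in `K` every successor is bounded by the maximum, and exits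
  -- lie strictly below it. As the mean over the successors equals the maximum, there is no exit and
  -- all successors are maximizers.
  have key : ∀ z ∈ K, h z = h z₀ → ∀ w, N.step z w ≠ 0 → w ∈ K ∧ h w = h z₀ := by
    intro z hz hzm w hw
    have hle : ∀ w, N.step z w ≠ 0 → h w ≤ h z₀ := by
      intro w hw
      by_cases hwK : w ∈ K
      · exact hmax w hwK
      · exact (hc z hz w hwK hw).le.trans hzm.le
    have heq : h w = h z₀ := by
      refine le_antisymm (hle w hw) (not_lt.1 fun hlt => ?_)
      have hs : ∑' y, N.step z y * h y < ∑' y, N.step z y * h z₀ := by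
        refine ENNReal.tsum_lt_tsum (i := w) ?_ ?_ ?_
        · rw [← hh]; exact hfin z
        · intro y
          by_cases hy : N.step z y = 0
          · simp [hy]
          · gcongr
            exact hle y hy
        · exact (ENNReal.mul_lt_mul_iff_right hw (PMF.apply_ne_top _ _)).2 hlt
      rw [← hh, ENNReal.tsum_mul_right, PMF.tsum_coe, one_mul, hzm] at hs
      exact lt_irrefl _ hs
    refine ⟨by_contra fun hwK => ?_, heq⟩
    exact absurd (hc z hz w hwK hw) (not_lt.2 (by rw [heq, hzm]))
  -- Strong connectedness spreads the maximum over all of `K`, so `K` would be closed.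
  refine hcl fun u hu v huv => ?_
  have hum : u ∈ K ∧ h u = h z₀ := by
    have := hsc z₀ hz₀ u hu
    clear hu huv
    induction this with
    | single h1 => exact key _ hz₀ rfl _ h1
    | tail _ h1 ih => exact key _ ih.1 ih.2 _ h1
  exact (key u hum.1 hum.2 v huv).1

-- In the mean `h z = ∑ P(z, w) h w`, the exit to `t` alone contributes at least `δ * h z`, which
-- leaves at most `(1 - δ) * h z` for the moves inside `K`.
open Classical in
theorem exists_tsum_indicator_le [Finite V] {N : MarkovChain V} {h : V → ℝ≥0∞}
    (hh : ∀ v, h v = ∑' w, N.step v w * h w) (hfin : ∀ v, h v ≠ ∞) {x δ : ℝ≥0∞}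
    (hδ : ∀ u v, N.step u v ≠ 0 → δ ≤ N.step u v) (hx : x + δ = 1) {K : Set V}
    (hne : K.Nonempty) (hsc : N.StronglyConnected K) (hcl : ¬ N.Closed K) :
    ∃ z ∈ K, ∑' w, (if w ∈ K then N.step z w * h w else 0) ≤ x * h z := by
  obtain ⟨z, hz, t, ht, hzt, hle⟩ := exists_exit_of_harmonic hh hfin hne hsc hcl
  refine ⟨z, hz, ?_⟩
  have hδ1 : δ ≠ ∞ := by
    intro h; rw [h] at hx; simp at hx
  refine (ENNReal.add_le_add_iff_right (ENNReal.mul_ne_top hδ1 (hfin z))).1 ?_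
  calc ∑' w, (if w ∈ K then N.step z w * h w else 0) + δ * h z
      ≤ ∑' w, (if w ∈ K then N.step z w * h w else 0) +
        ∑' w, (if w = t then N.step z t * h t else 0) := by
        rw [tsum_ite_eq]
        gcongr
        exact hδ z t hzt
    _ = ∑' w, ((if w ∈ K then N.step z w * h w else 0) +
        if w = t then N.step z t * h t else 0) := ENNReal.tsum_add.symm
    _ ≤ ∑' w, N.step z w * h w := by
        refine ENNReal.tsum_le_tsum fun w => ?_
        by_cases hw : w = t
        · subst hw; simp [ht]
        · simp only [hw, if_false, add_zero]
          split_ifs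
          · exact le_rfl
          · exact zero_le
    _ = x * h z + δ * h z := by rw [← hh, ← add_mul, hx, one_mul]

theorem candidateVisits_eq_dropLast_append {π : List V} {K : Set V} (h : IsCandidate π K) {v : V}
    (hv : π.getLast? = some v) :
    candidateVisits π = (candidateVisits π).dropLast ++ [v] := by
  have hπ : π ≠ [] := by rintro rfl; simp at hv
  have hlen : 0 < π.length := List.length_pos_iff.2 hπ
  have hle : sInf {n | candidate (π.take (n + 1)) = candidate π} ≤ π.length - 1 := by
    apply Nat.sInf_le
    change candidate (π.take (π.length - 1 + 1)) = candidate π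
    rw [Nat.sub_add_cancel hlen, List.take_length]
  have hne : candidateVisits π ≠ [] := by
    unfold candidateVisits
    rw [Ne, List.drop_eq_nil_iff]
    omega
  have hl : (candidateVisits π).getLast hne = v := by
    refine (List.getLast_drop (l := π) hne).trans ?_
    rw [List.getLast?_eq_some_getLast hπ] at hv
    exact Option.some.inj hv
  rw [← hl, List.dropLast_append_getLast]

open Classical in
/-- The bound for the probability that the current candidate, if it is not closed, still reaches
the required strength. -/
noncomputable def MarkovChain.currentRisk (N : MarkovChain V) (x : ℝ≥0∞) (k : ℕ → ℕ)
    (z : Set V → V) (π : List V) : ℝ≥0∞ :=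
  match candidate π with
  | none => 0
  | some K => if N.Closed K then 0 else
      x ^ (k (candidateIndex π) - (candidateVisits π).dropLast.count (z K))

theorem MarkovChain.currentRisk_of_none {N : MarkovChain V} {x : ℝ≥0∞} {k : ℕ → ℕ}
    {z : Set V → V} {π : List V} (h : candidate π = none) : N.currentRisk x k z π = 0 := by
  unfold MarkovChain.currentRisk
  simp only [h]

theorem MarkovChain.currentRisk_of_closed {N : MarkovChain V} {x : ℝ≥0∞} {k : ℕ → ℕ}
    {z : Set V → V} {π : List V} {K : Set V} (h : IsCandidate π K) (hK : N.Closed K) :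
    N.currentRisk x k z π = 0 := by
  unfold MarkovChain.currentRisk
  simp only [candidate_eq_some_iff.2 h, if_pos hK]

open Classical in
theorem MarkovChain.currentRisk_of_not_closed {N : MarkovChain V} {x : ℝ≥0∞} {k : ℕ → ℕ}
    {z : Set V → V} {π : List V} {K : Set V} (h : IsCandidate π K) (hK : ¬ N.Closed K) :
    N.currentRisk x k z π =
      x ^ (k (candidateIndex π) - (candidateVisits π).dropLast.count (z K)) := by
  unfold MarkovChain.currentRisk
  simp only [candidate_eq_some_iff.2 h, if_neg hK]

/-- The data of the supermartingale argument: `h` is harmonic, `x` bounds the probability (weighted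
with `h`) of not leaving a non-closed strongly connected set `K` at `z K`, and `a i` bounds the
risk of all candidates with an index greater than `i`. -/
structure RiskBound (N : MarkovChain V) (h : V → ℝ≥0∞) (x : ℝ≥0∞) (k : ℕ → ℕ) (a : ℕ → ℝ≥0∞)
    (z : Set V → V) : Prop where
  harmonic : ∀ v, h v = ∑' w, N.step v w * h w
  le_one : x ≤ 1
  step : ∀ i, a (i + 1) + x ^ k (i + 1) ≤ a i
  mem : ∀ K : Set V, K.Nonempty → N.StronglyConnected K → ¬ N.Closed K → z K ∈ K
  exit : ∀ K : Set V, K.Nonempty → N.StronglyConnected K → ¬ N.Closed K →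
    ∑' w, K.indicator (fun w => N.step (z K) w * h w) w ≤ x * h (z K)

variable {N : MarkovChain V} {h : V → ℝ≥0∞} {x : ℝ≥0∞} {k : ℕ → ℕ} {a : ℕ → ℝ≥0∞} {z : Set V → V}

/-- A newborn candidate takes its initial risk `x ^ k (i + 1)` out of the budget `a i` for later
candidates; an undefined or closed candidate costs nothing. -/
theorem RiskBound.risk_concat_le_of_not_mem (R : RiskBound N h x k a z) {π : List V} {w : V}
    (hnew : ∀ K, IsCandidate (π ++ [w]) K → ¬ IsCandidate π K ∨ N.Closed K) :
    a (candidateIndex (π ++ [w])) + N.currentRisk x k z (π ++ [w]) ≤ a (candidateIndex π) := by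
  cases hc : candidate (π ++ [w]) with
  | none => rw [candidateIndex_concat_of_none hc, MarkovChain.currentRisk_of_none hc, add_zero]
  | some K =>
    have hK := candidate_eq_some_iff.1 hc
    by_cases hπ : IsCandidate π K
    · have hcl : N.Closed K := (hnew K hK).resolve_left (fun h => h hπ)
      rw [MarkovChain.currentRisk_of_closed hK hcl, add_zero,
        candidateIndex_concat_of_mem hπ ((isCandidate_concat_iff hπ).1 hK)]
    · rw [candidateIndex_concat_of_new hK hπ]
      refine le_trans ?_ (R.step _)
      gcongr
      by_cases hcl : N.Closed K
      · rw [MarkovChain.currentRisk_of_closed hK hcl]; exact zero_le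
      · rw [MarkovChain.currentRisk_of_not_closed hK hcl, candidateVisits_concat_of_new hK hπ,
          candidateIndex_concat_of_new hK hπ]
        simp

/-- The supermartingale property. Outside the current candidate the budget `a` pays for whatever
comes next. Inside it, a departure from `z K` uses up one factor `x`, which `R.exit` provides; from
any other state the exponent stays the same and harmonicity suffices. -/
theorem RiskBound.tsum_risk_le (R : RiskBound N h x k a z) {π : List V} (hπ : N.IsPath π) :
    ∑' w, N.nextState π w * (h w *
      (a (candidateIndex (π ++ [w])) + N.currentRisk x k z (π ++ [w]))) ≤
    N.lastValue h π * (a (candidateIndex π) + N.currentRisk x k z π) := by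
  classical
  by_cases hA : ∃ K, IsCandidate π K ∧ ¬ N.Closed K
  · obtain ⟨K, hK, hcl⟩ := hA
    obtain ⟨⟨v, hv, hvK⟩, hB⟩ := isCandidate_iff.1 hK
    have hsc := hπ.stronglyConnected hK
    -- The exponent after one more step inside `K`: the last state of `π` now counts as left, so
    -- `dropLast` disappears.
    set e := k (candidateIndex π) - (candidateVisits π).count (z K) with he
    have hw : ∀ w, h w * (a (candidateIndex (π ++ [w])) + N.currentRisk x k z (π ++ [w])) ≤
        h w * a (candidateIndex π) + K.indicator (fun w => h w * x ^ e) w := by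
      intro w
      by_cases hwK : w ∈ K
      · have hK' := hK.concat hwK
        rw [MarkovChain.currentRisk_of_not_closed hK' hcl, candidateIndex_concat_of_mem hK hwK,
          candidateVisits_concat_of_mem hK hwK, List.dropLast_concat, Set.indicator_of_mem hwK,
          mul_add]
      · rw [Set.indicator_of_notMem hwK, add_zero]
        gcongr
        refine R.risk_concat_le_of_not_mem fun K' hK' => Or.inl fun h1 => ?_
        obtain rfl := h1.unique hK
        exact hwK ((isCandidate_concat_iff hK).1 hK')
    rw [MarkovChain.currentRisk_of_not_closed hK hcl,
      MarkovChain.lastValue_of_getLast? R.harmonic hv, N.nextState_of_getLast? hv]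
    have hind : ∀ w, N.step v w * K.indicator (fun w => h w * x ^ e) w =
        K.indicator (fun w => N.step v w * h w) w * x ^ e := by
      intro w
      by_cases hwK : w ∈ K
      · simp [hwK, mul_assoc]
      · simp [hwK]
    have hcount : (candidateVisits π).count (z K) =
        (candidateVisits π).dropLast.count (z K) + if v = z K then 1 else 0 := by
      conv_lhs => rw [candidateVisits_eq_dropLast_append hK hv, List.count_append]
      simp [List.count_singleton]
    calc ∑' w, N.step v w * (h w *
          (a (candidateIndex (π ++ [w])) + N.currentRisk x k z (π ++ [w])))
        ≤ ∑' w, N.step v w * (h w * a (candidateIndex π) +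
            K.indicator (fun w => h w * x ^ e) w) := by
          refine ENNReal.tsum_le_tsum fun w => ?_
          gcongr
          exact hw w
      _ = h v * a (candidateIndex π) +
            (∑' w, K.indicator (fun w => N.step v w * h w) w) * x ^ e := by
          simp_rw [mul_add, hind, ← mul_assoc]
          rw [ENNReal.tsum_add, ENNReal.tsum_mul_right, ENNReal.tsum_mul_right, ← R.harmonic]
      _ ≤ h v * a (candidateIndex π) + h v * x ^ (k (candidateIndex π) -
            (candidateVisits π).dropLast.count (z K)) := by
          refine add_le_add le_rfl ?_
          by_cases hvz : v = z K
          · calc (∑' w, K.indicator (fun w => N.step v w * h w) w) * x ^ e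
                ≤ (x * h v) * x ^ e := by
                  gcongr
                  rw [hvz]
                  exact R.exit K hB.1 hsc hcl
              _ = h v * x ^ (e + 1) := by rw [pow_succ]; ring
              -- Only an inequality of exponents holds, because the natural subtraction in `e` may
              -- already have been truncated to zero.
              _ ≤ h v * x ^ (k (candidateIndex π) -
                  (candidateVisits π).dropLast.count (z K)) := by
                  refine mul_le_mul_right ?_ _
                  refine pow_le_pow_right_of_le_one' R.le_one ?_
                  rw [if_pos hvz] at hcount
                  omega
          · rw [if_neg hvz, add_zero] at hcount
            rw [he, hcount]
            gcongr
            conv_rhs => rw [R.harmonic v]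
            refine ENNReal.tsum_le_tsum fun w => ?_
            exact Set.indicator_le_self _ _ w
      _ = _ := by rw [mul_add]
  · push Not at hA
    calc ∑' w, N.nextState π w * (h w *
          (a (candidateIndex (π ++ [w])) + N.currentRisk x k z (π ++ [w])))
        ≤ ∑' w, N.nextState π w * (h w * a (candidateIndex π)) := by
          refine ENNReal.tsum_le_tsum fun w => ?_
          gcongr
          refine R.risk_concat_le_of_not_mem fun K' _ => ?_
          by_cases h1 : IsCandidate π K'
          · exact Or.inr (hA K' h1)
          · exact Or.inl h1
      _ = N.lastValue h π * a (candidateIndex π) := by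
          simp_rw [← mul_assoc]
          rw [ENNReal.tsum_mul_right]
          rfl
      _ ≤ _ := by gcongr; exact le_self_add

/-- At a reset the risk has reached `1`, or `h` is zero because the bad candidate is closed. The
extra occurrence of the last state in the definition of strength matters here: the final visit has
not been followed by a step, so only `dropLast` counts departures from `z K`. -/
theorem RiskBound.lastValue_le_risk (R : RiskBound N h x k a z) {good : Set V → Prop}
    (hbad : ∀ K, N.Closed K → N.StronglyConnected K → ¬ good K → ∀ v ∈ K, h v = 0)
    {π : List V} (hπ : N.IsPath π) {K : Set V} (hK : IsCandidate π K) (hKg : ¬ good K)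
    (hk : k (candidateIndex π) ≤ strength π) :
    N.lastValue h π ≤ N.lastValue h π * (a (candidateIndex π) + N.currentRisk x k z π) := by
  classical
  obtain ⟨⟨v, hv, hvK⟩, hB⟩ := isCandidate_iff.1 hK
  have hsc := hπ.stronglyConnected hK
  by_cases hcl : N.Closed K
  · rw [MarkovChain.lastValue_of_getLast? R.harmonic hv, hbad K hcl hsc hKg v hvK]
    exact zero_le
  · obtain ⟨h1, h2⟩ := count_of_le_strength hK hk
    have hl := candidateVisits_eq_dropLast_append hK hv
    have hlast : v ∈ (candidateVisits π).getLast? := by rw [hl]; simp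
    have hcount : (candidateVisits π).count (z K) =
        (candidateVisits π).dropLast.count (z K) + if v = z K then 1 else 0 := by
      conv_lhs => rw [hl, List.count_append]
      simp [List.count_singleton]
    have hle : k (candidateIndex π) ≤ (candidateVisits π).dropLast.count (z K) := by
      by_cases hvz : v = z K
      · have := h2 v hlast
        rw [if_pos hvz] at hcount
        rw [hvz, hcount] at this
        omega
      · have := h1 (z K) (R.mem K hB.1 hsc hcl)
        rw [if_neg hvz] at hcount
        omega
    rw [MarkovChain.currentRisk_of_not_closed hK hcl, Nat.sub_eq_zero_of_le hle, pow_zero]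
    exact le_mul_of_one_le_right' le_add_self

/-- The main estimate. -/
theorem RiskBound.lastValue_le_stayProb_add (R : RiskBound N h x k a z) {good : Set V → Prop}
    (h_one : ∀ v, h v ≤ 1)
    (hbad : ∀ K, N.Closed K → N.StronglyConnected K → ¬ good K → ∀ v ∈ K, h v = 0)
    {C : List V → Prop}
    (hC : ∀ π, C π → ∃ K, IsCandidate π K ∧ ¬ good K ∧ k (candidateIndex π) ≤ strength π)
    (n : ℕ) {π : List V} (hπ : N.IsPath π) :
    N.lastValue h π ≤ N.stayProb C n π +
      N.lastValue h π * (a (candidateIndex π) + N.currentRisk x k z π) := by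
  induction n generalizing π with
  | zero =>
    refine le_trans ?_ le_self_add
    calc N.lastValue h π ≤ ∑' w, N.nextState π w * 1 := by
          refine ENNReal.tsum_le_tsum fun w => ?_
          gcongr
          exact h_one w
      _ = 1 := by simp [PMF.tsum_coe]
  | succ n ih =>
    by_cases hc : C π
    · obtain ⟨K, h1, h2, h3⟩ := hC π hc
      exact (R.lastValue_le_risk hbad hπ h1 h2 h3).trans le_add_self
    · rw [MarkovChain.stayProb, if_neg hc]
      -- Without a reset, the supermartingale inequality reduces the claim to the one-step
      -- extensions, where the induction hypothesis applies.
      refine le_trans ?_ (add_le_add le_rfl (R.tsum_risk_le hπ))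
      rw [← ENNReal.tsum_add]
      refine ENNReal.tsum_le_tsum fun w => ?_
      by_cases hw : N.nextState π w = 0
      · simp [hw]
      · rw [← mul_add]
        gcongr
        have := ih (hπ.concat hw)
        rwa [MarkovChain.lastValue_concat R.harmonic] at this

theorem RiskBound.lastValue_nil_le (R : RiskBound N h x k a z) {good : Set V → Prop}
    (h_one : ∀ v, h v ≤ 1)
    (hbad : ∀ K, N.Closed K → N.StronglyConnected K → ¬ good K → ∀ v ∈ K, h v = 0)
    {C : List V → Prop}
    (hC : ∀ π, C π → ∃ K, IsCandidate π K ∧ ¬ good K ∧ k (candidateIndex π) ≤ strength π)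
    (n : ℕ) : ∑' w, N.init w * h w ≤ N.stayProb C n [] + (∑' w, N.init w * h w) * a 0 := by
  have := R.lastValue_le_stayProb_add h_one hbad hC n N.isPath_nil
  rwa [candidateIndex_nil, MarkovChain.currentRisk_of_none candidate_nil, add_zero] at this

end Potential

/-! ### The bound for the probability of no reset -/

/-- The right side is `2 ^ (-t)` with `t = i - log₂ ε`. Since `α * log₂ (1 - p) ≤ -1`, raising `1 -
p` to a power of at least `α * t` gives at most that. -/
theorem one_sub_pow_ceil_le {p α ε : ℝ} (hp : 0 < p) (hp1 : p ≤ 1)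
    (hα : max 1 (-1 / Real.logb 2 (1 - p)) ≤ α) (hε : 0 < ε) (i : ℕ) :
    (1 - p) ^ ⌈α * ((i : ℝ) - Real.logb 2 ε)⌉₊ ≤ ε * (1 / 2) ^ i := by
  have h1 : 1 ≤ α := (le_max_left _ _).trans hα
  have h2 : -1 / Real.logb 2 (1 - p) ≤ α := (le_max_right _ _).trans hα
  set t := (i : ℝ) - Real.logb 2 ε with ht
  have hrhs : ε * (1 / 2) ^ i = (2 : ℝ) ^ (-t) := by
    rw [ht, neg_sub, Real.rpow_sub (by norm_num), Real.rpow_logb (by norm_num) (by norm_num) hε,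
      Real.rpow_natCast]
    simp [div_eq_mul_inv]
  rw [hrhs]
  rcases le_or_gt t 0 with ht0 | ht0
  · refine (pow_le_one₀ (by linarith) (by linarith)).trans ?_
    exact Real.one_le_rpow (by norm_num) (by linarith)
  · have hk : 0 < ⌈α * t⌉₊ := Nat.ceil_pos.2 (by positivity)
    -- For `p = 1` the logarithm carries no information; `α ≥ 1` makes the exponent positive, and
    -- the power is zero.
    rcases eq_or_lt_of_le hp1 with rfl | hlt
    · rw [sub_self, zero_pow hk.ne']
      positivity
    · have hL : Real.logb 2 (1 - p) < 0 := Real.logb_neg (by norm_num) (by linarith) (by linarith)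
      have h3 : α * Real.logb 2 (1 - p) ≤ -1 := by
        rwa [div_le_iff_of_neg hL] at h2
      have h4 : (⌈α * t⌉₊ : ℝ) * Real.logb 2 (1 - p) ≤ -t := by
        calc (⌈α * t⌉₊ : ℝ) * Real.logb 2 (1 - p) ≤ (α * t) * Real.logb 2 (1 - p) :=
              mul_le_mul_of_nonpos_right (Nat.le_ceil _) hL.le
          _ = t * (α * Real.logb 2 (1 - p)) := by ring
          _ ≤ t * (-1) := by gcongr
          _ = -t := by ring
      have h5 : (1 - p) ^ ⌈α * t⌉₊ = (2 : ℝ) ^ ((⌈α * t⌉₊ : ℝ) * Real.logb 2 (1 - p)) := by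
        rw [mul_comm (⌈α * t⌉₊ : ℝ), Real.rpow_mul (by norm_num), Real.rpow_logb (by norm_num) (by norm_num)
          (by linarith), Real.rpow_natCast]
      rw [h5]
      exact Real.rpow_le_rpow_of_exponent_le (by norm_num) h4

theorem MarkovChain.finite_probabilities {S : Type*} [Finite S] (M : MarkovChain S) :
    {x : ℝ | ∃ s t, M.step s t ≠ 0 ∧ x = (M.step s t).toReal}.Finite := by
  refine (Set.finite_range fun st : S × S => (M.step st.1 st.2).toReal).subset ?_
  rintro x ⟨s, t, -, rfl⟩
  exact ⟨(s, t), rfl⟩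

theorem MarkovChain.pmin_le {S : Type*} [Finite S] (M : MarkovChain S) {s t : S}
    (h : M.step s t ≠ 0) : ENNReal.ofReal M.pmin ≤ M.step s t := by
  rw [← ENNReal.ofReal_toReal (PMF.apply_ne_top (M.step s) t)]
  exact ENNReal.ofReal_le_ofReal
    (csInf_le M.finite_probabilities.bddBelow ⟨s, t, h, rfl⟩)

theorem MarkovChain.exists_pmin_eq {S : Type*} [Finite S] (M : MarkovChain S) :
    ∃ s t, M.step s t ≠ 0 ∧ M.pmin = (M.step s t).toReal := by
  obtain ⟨s, -⟩ := M.init.support_nonempty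
  obtain ⟨t, ht⟩ := (M.step s).support_nonempty
  have hne : {x : ℝ | ∃ s t, M.step s t ≠ 0 ∧ x = (M.step s t).toReal}.Nonempty :=
    ⟨_, s, t, (PMF.mem_support_iff _ _).1 ht, rfl⟩
  exact hne.csInf_mem M.finite_probabilities

theorem MarkovChain.pmin_pos {S : Type*} [Finite S] (M : MarkovChain S) : 0 < M.pmin := by
  obtain ⟨s, t, h, h'⟩ := M.exists_pmin_eq
  rw [h']
  exact ENNReal.toReal_pos h (PMF.apply_ne_top _ _)

theorem MarkovChain.pmin_le_one {S : Type*} [Finite S] (M : MarkovChain S) : M.pmin ≤ 1 := by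
  obtain ⟨s, t, h, h'⟩ := M.exists_pmin_eq
  rw [h']
  exact ENNReal.toReal_le_of_le_ofReal zero_le_one (by simpa using PMF.coe_le_one _ _)

section Product

variable {S Ap Q : Type*} (M : LabelledMarkovChain S Ap) (D : DRA (Set Ap) Q)

theorem LabelledMarkovChain.product_step_ne_zero_iff (x y : S × Q) :
    (M.product D).step x y ≠ 0 ↔ y.2 = D.step x.2 (M.label y.1) ∧ M.step x.1 y.1 ≠ 0 := by
  rw [← PMF.mem_support_iff]
  simp only [LabelledMarkovChain.product, PMF.support_map, Set.mem_image, PMF.mem_support_iff]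
  constructor
  · rintro ⟨t, ht, rfl⟩
    exact ⟨rfl, ht⟩
  · rintro ⟨h1, h2⟩
    exact ⟨y.1, h2, Prod.ext rfl h1.symm⟩

theorem LabelledMarkovChain.product_init_ne_zero {y : S × Q} (h : (M.product D).init y ≠ 0) :
    y.2 = D.step D.start (M.label y.1) := by
  rw [← PMF.mem_support_iff] at h
  simp only [LabelledMarkovChain.product, PMF.support_map, Set.mem_image] at h
  obtain ⟨t, -, rfl⟩ := h
  rfl

theorem LabelledMarkovChain.pmin_le_product_step [Finite S] {x y : S × Q}
    (h : (M.product D).step x y ≠ 0) : ENNReal.ofReal M.pmin ≤ (M.product D).step x y := by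
  classical
  obtain ⟨h1, h2⟩ := (M.product_step_ne_zero_iff D x y).1 h
  refine (M.pmin_le h2).trans ?_
  simp only [LabelledMarkovChain.product, PMF.map_apply]
  refine le_trans ?_ (ENNReal.le_tsum y.1)
  rw [if_pos (show y = (y.1, D.step x.2 (M.label y.1)) from Prod.ext rfl h1)]

theorem LabelledMarkovChain.prob_le_stayProb_add [Finite S] [Finite Q] (φ : LTL Ap)
    (hD : ∀ w : ℕ → Set Ap, D.Accepts w ↔ φ.Sat w) {α ε : ℝ} (hα : M.alpha0 ≤ α) (hε : 0 < ε)
    (n : ℕ) : ENNReal.ofReal (M.prob φ) ≤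
      (M.product D).stayProb (ResetCondition D α ε) n [] +
        ENNReal.ofReal (M.prob φ) * ENNReal.ofReal ε := by
  classical
  have hp := M.pmin_pos
  have hp1 := M.pmin_le_one
  set x : ℝ≥0∞ := ENNReal.ofReal (1 - M.pmin) with hx
  have hxp : x + ENNReal.ofReal M.pmin = 1 := by
    rw [hx, ← ENNReal.ofReal_add (by linarith) hp.le]; simp
  have hfin : ∀ v, M.accProb D v ≠ ∞ := fun v =>
    ((M.accProb_le_one D v).trans_lt ENNReal.one_lt_top).ne
  have hz : ∀ K : Set (S × Q), ∃ z, K.Nonempty → (M.product D).StronglyConnected K →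
      ¬ (M.product D).Closed K → z ∈ K ∧
      ∑' w, (if w ∈ K then (M.product D).step z w * M.accProb D w else 0) ≤
        x * M.accProb D z := by
    intro K
    by_cases hK : K.Nonempty ∧ (M.product D).StronglyConnected K ∧ ¬ (M.product D).Closed K
    · obtain ⟨z, h1, h2⟩ := exists_tsum_indicator_le (M.accProb_harmonic D) hfin
        (fun u v => M.pmin_le_product_step D) hxp hK.1 hK.2.1 hK.2.2
      exact ⟨z, fun _ _ _ => ⟨h1, h2⟩⟩
    · obtain ⟨z, -⟩ := (M.product D).init.support_nonempty
      exact ⟨z, fun h1 h2 h3 => absurd ⟨h1, h2, h3⟩ hK⟩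
  choose z hz using hz
  -- The thresholds are those of the reset condition. The budget `ε / 2 ^ i` is the sum of the
  -- geometric series of bounds for all indices above `i`.
  have R : RiskBound (M.product D) (M.accProb D) x
      (fun i => ⌈α * ((i : ℝ) - Real.logb 2 ε)⌉₊)
      (fun i => ENNReal.ofReal (ε * (1 / 2) ^ i)) z := by
    refine ⟨M.accProb_harmonic D, ?_, fun i => ?_, fun K h1 h2 h3 => (hz K h1 h2 h3).1,
      fun K h1 h2 h3 => ?_⟩
    · rw [← hxp]; exact le_self_add
    · have h1 := one_sub_pow_ceil_le hp hp1 hα hε (i + 1)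
      rw [hx, ← ENNReal.ofReal_pow (by linarith)]
      calc _ ≤ ENNReal.ofReal (ε * (1 / 2) ^ (i + 1)) + ENNReal.ofReal (ε * (1 / 2) ^ (i + 1)) := by
            gcongr
        _ = _ := by
            rw [← ENNReal.ofReal_add (by positivity) (by positivity)]
            congr 1
            rw [pow_succ]; ring
    · refine le_of_eq_of_le ?_ (hz K h1 h2 h3).2
      rfl
  have := R.lastValue_nil_le (good := D.Good) (C := ResetCondition D α ε)
    (fun v => M.accProb_le_one D v)
    (fun K h1 h2 h3 v hv => M.accProb_eq_zero D h1 h2 h3 hv) ?_ n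
  · rw [← M.ofReal_prob φ D hD] at this
    simpa using this
  · rintro π ⟨⟨K, hK, hKg⟩, h⟩
    refine ⟨K, candidate_eq_some_iff.1 hK, hKg, Nat.ceil_le.2 h⟩

theorem LabelledMarkovChain.prob_mul_one_sub_le_stayProb [Finite S] [Finite Q] (φ : LTL Ap)
    (hD : ∀ w : ℕ → Set Ap, D.Accepts w ↔ φ.Sat w) {α ε : ℝ} (hα : M.alpha0 ≤ α) (hε : 0 < ε)
    (n : ℕ) : ENNReal.ofReal (M.prob φ * (1 - ε)) ≤
      (M.product D).stayProb (ResetCondition D α ε) n [] := by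
  have h0 : 0 ≤ M.prob φ := measureReal_nonneg
  rcases le_or_gt 1 ε with h | h
  · rw [ENNReal.ofReal_of_nonpos (by nlinarith)]
    exact zero_le
  · have := M.prob_le_stayProb_add D φ hD hα hε n
    rw [← ENNReal.ofReal_mul h0] at this
    refine (ENNReal.add_le_add_iff_right (ENNReal.ofReal_ne_top (r := M.prob φ * ε))).1 ?_
    rw [← ENNReal.ofReal_add (by nlinarith) (by positivity)]
    convert this using 2
    ring

end Product

/-! ### Positivity of the probability of no reset -/

section Positivity

variable {V : Type*}

/-- There is a walk of length `n` from a state to `f`. -/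
def WalkTo (E : V → V → Prop) (f : V) : ℕ → V → Prop
  | 0, u => u = f
  | n + 1, u => ∃ v, E u v ∧ WalkTo E f n v

theorem WalkTo.reflTransGen {E : V → V → Prop} {f : V} {n : ℕ} {u : V} (h : WalkTo E f n u) :
    Relation.ReflTransGen E u f := by
  induction n generalizing u with
  | zero => rw [h]
  | succ n ih =>
    obtain ⟨v, h1, h2⟩ := h
    exact Relation.ReflTransGen.head h1 (ih h2)

theorem exists_walkTo {E : V → V → Prop} {f u : V} (h : Relation.ReflTransGen E u f) :
    ∃ n, WalkTo E f n u := by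
  induction h using Relation.ReflTransGen.head_induction_on with
  | refl => exact ⟨0, rfl⟩
  | head h1 _ ih =>
    obtain ⟨n, hn⟩ := ih
    exact ⟨n + 1, _, h1, hn⟩

/-- A choice of successors that leads to `f`. -/
theorem exists_next (E : V → V → Prop) (f : V) : ∃ (d : V → ℕ) (nx : V → V), ∀ u, u ≠ f →
    Relation.ReflTransGen E u f →
    E u (nx u) ∧ Relation.ReflTransGen E (nx u) f ∧ d (nx u) < d u := by
  have : ∀ u, ∃ v, u ≠ f → Relation.ReflTransGen E u f →
      E u v ∧ Relation.ReflTransGen E v f ∧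
        sInf {n | WalkTo E f n v} < sInf {n | WalkTo E f n u} := by
    intro u
    by_cases hu : u ≠ f ∧ Relation.ReflTransGen E u f
    · obtain ⟨h1, h2⟩ := hu
      have hmem : sInf {n | WalkTo E f n u} ∈ {n | WalkTo E f n u} := Nat.sInf_mem (exists_walkTo h2)
      cases hm : sInf {n | WalkTo E f n u} with
      | zero =>
        rw [hm] at hmem
        exact absurd hmem h1
      | succ m =>
        rw [hm] at hmem
        obtain ⟨v, hv1, hv2⟩ := hmem
        exact ⟨v, fun _ _ => ⟨hv1, hv2.reflTransGen, Nat.lt_succ_of_le (Nat.sInf_le hv2)⟩⟩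
    · exact ⟨u, fun h1 h2 => absurd ⟨h1, h2⟩ hu⟩
  choose nx hnx using this
  exact ⟨fun u => sInf {n | WalkTo E f n u}, nx, hnx⟩

variable (N : MarkovChain V) (f : V) (nx : V → V)

/-- A path that can still reach `f` and that, after the first visit to a state other than `f`,
moves to the chosen successor. -/
structure SafePath (π : List V) : Prop where
  isPath : N.IsPath π
  reach : ∀ u ∈ π, Relation.ReflTransGen (fun a b => N.step a b ≠ 0) u f
  next : ∀ u ∈ π.dropLast, u ≠ f → pathEdge π u (nx u)

variable {N f nx}

theorem mem_iff_mem_dropLast_or {π : List V} {v : V} (hv : π.getLast? = some v) (u : V) :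
    u ∈ π ↔ u ∈ π.dropLast ∨ u = v := by
  obtain ⟨s, rfl⟩ := List.getLast?_eq_some_iff.1 hv
  simp

theorem SafePath.concat {π : List V} (h : SafePath N f nx π) {v w : V}
    (hv : π.getLast? = some v) (hw : N.step v w ≠ 0)
    (hwf : Relation.ReflTransGen (fun a b => N.step a b ≠ 0) w f)
    (hc : v ∈ π.dropLast ∨ v = f ∨ w = nx v) : SafePath N f nx (π ++ [w]) := by
  refine ⟨h.isPath.concat (by rwa [N.nextState_of_getLast? hv]), ?_, ?_⟩
  · intro u hu
    rcases List.mem_append.1 hu with hu | hu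
    · exact h.reach u hu
    · rwa [List.mem_singleton.1 hu]
  · intro u hu huf
    rw [List.dropLast_concat, mem_iff_mem_dropLast_or hv] at hu
    rw [pathEdge_concat_iff]
    by_cases hud : u ∈ π.dropLast
    · exact Or.inl (h.next u hud huf)
    · obtain rfl := hu.resolve_left hud
      exact Or.inr ⟨hv, ((hc.resolve_left hud).resolve_left huf).symm⟩

/-- Every state of a candidate is the source of an edge of the path, so the path also contains its
chosen edge. Bottomness keeps the chosen successors in `K`, and they descend to `f`. -/
theorem SafePath.mem_candidate {d : V → ℕ}
    (hnx : ∀ u, u ≠ f → Relation.ReflTransGen (fun a b => N.step a b ≠ 0) u f →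
      N.step u (nx u) ≠ 0 ∧ Relation.ReflTransGen (fun a b => N.step a b ≠ 0) (nx u) f ∧
        d (nx u) < d u)
    {π : List V} (h : SafePath N f nx π) {K : Set V} (hK : IsCandidate π K) : f ∈ K := by
  obtain ⟨-, hB⟩ := isCandidate_iff.1 hK
  have key : ∀ n, ∀ u ∈ K, d u = n → f ∈ K := by
    intro n
    induction n using Nat.strong_induction_on with
    | _ n ih =>
      intro u hu hd
      by_cases huf : u = f
      · rwa [← huf]
      · obtain ⟨v, -, huv⟩ := hB.exists_edge hu
        have h1 := h.next u (pathEdge_mem_dropLast huv) huf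
        have h2 := (hnx u huf (h.reach u (pathEdge_mem_left huv))).2.2
        exact ih _ (hd ▸ h2) (nx u) (hB.2.2 u hu _ h1) rfl
  obtain ⟨u, hu⟩ := hB.1
  exact key _ u hu rfl

/-- One step from a safe path. -/
def SafeStep (N : MarkovChain V) (f : V) (nx : V → V) (π π' : List V) : Prop :=
  SafePath N f nx π ∧ ∃ w, N.nextState π w ≠ 0 ∧ π' = π ++ [w]

theorem SafeStep.subset {π π' : List V}
    (h : Relation.ReflTransGen (SafeStep N f nx) π π') : π ⊆ π' := by
  induction h with
  | refl => exact List.Subset.refl _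
  | tail _ h ih =>
    obtain ⟨-, w, -, rfl⟩ := h
    exact fun u hu => List.mem_append_left _ (ih hu)

/-- Each of the finitely many steps multiplies the lower bound by a positive transition probability,
and no reset occurs on the way. -/
theorem exists_le_stayProb_of_safeStep {C : List V → Prop}
    (hC : ∀ π, SafePath N f nx π → ¬ C π) {π π' : List V}
    (h : Relation.ReflTransGen (SafeStep N f nx) π π')
    (h' : ∃ c : ℝ≥0∞, c ≠ 0 ∧ ∀ n, c ≤ N.stayProb C n π') :
    ∃ c : ℝ≥0∞, c ≠ 0 ∧ ∀ n, c ≤ N.stayProb C n π := by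
  induction h using Relation.ReflTransGen.head_induction_on with
  | refl => exact h'
  | head h1 _ ih =>
    obtain ⟨c, hc, hcn⟩ := ih
    obtain ⟨hs, w, hw, rfl⟩ := h1
    refine ⟨N.nextState _ w * c, mul_ne_zero hw hc, fun n => ?_⟩
    cases n with
    | zero => exact mul_le_one' (PMF.coe_le_one _ _) (hcn 0)
    | succ n =>
      rw [MarkovChain.stayProb, if_neg (hC _ hs)]
      refine le_trans ?_ (ENNReal.le_tsum w)
      gcongr
      exact hcn n

variable {d : V → ℕ}

theorem SafePath.exists_extension_to (hnx : ∀ u, u ≠ f →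
      Relation.ReflTransGen (fun a b => N.step a b ≠ 0) u f →
      N.step u (nx u) ≠ 0 ∧ Relation.ReflTransGen (fun a b => N.step a b ≠ 0) (nx u) f ∧
        d (nx u) < d u) (n : ℕ) {π : List V} {v : V} (h : SafePath N f nx π)
    (hv : π.getLast? = some v) (hd : d v = n) :
    ∃ π', Relation.ReflTransGen (SafeStep N f nx) π π' ∧ SafePath N f nx π' ∧
      π'.getLast? = some f := by
  induction n using Nat.strong_induction_on generalizing π v with
  | _ n ih =>
    by_cases hvf : v = f
    · exact ⟨π, Relation.ReflTransGen.refl, h, hvf ▸ hv⟩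
    · have hvm : v ∈ π := (mem_iff_mem_dropLast_or hv v).2 (Or.inr rfl)
      obtain ⟨h1, h2, h3⟩ := hnx v hvf (h.reach v hvm)
      have h4 := h.concat hv h1 h2 (Or.inr (Or.inr rfl))
      obtain ⟨π', h5, h6⟩ := ih _ (hd ▸ h3) h4 (by simp) rfl
      exact ⟨π', Relation.ReflTransGen.head
        ⟨h, nx v, by rwa [N.nextState_of_getLast? hv], rfl⟩ h5, h6⟩

/-- A walk from `f` to `v` can be followed safely through `f` and through states that have been left
before. If it meets any other state, that state is new and must first use its chosen edge; finding
it is progress too, which is the second alternative. -/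
theorem SafePath.exists_extension_visit {π : List V} (h : SafePath N f nx π)
    (hf : π.getLast? = some f) {B : Set V} (hB : N.Closed B) (hsc : N.StronglyConnected B)
    (hfB : f ∈ B) {v : V} (hv : Relation.ReflTransGen (fun a b => N.step a b ≠ 0) f v) :
    v ∈ B ∧ ∃ π', Relation.ReflTransGen (SafeStep N f nx) π π' ∧ SafePath N f nx π' ∧
      (∃ u ∈ B, π'.getLast? = some u) ∧
      (π'.getLast? = some v ∨ ∃ u ∈ B, u ∈ π' ∧ u ∉ π) := by
  induction hv with
  | refl => exact ⟨hfB, π, Relation.ReflTransGen.refl, h, ⟨f, hfB, hf⟩, Or.inl hf⟩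
  | @tail b c _ hbc ih =>
    obtain ⟨hbB, π', h1, h2, h3, h4⟩ := ih
    have hcB := hB b hbB c hbc
    refine ⟨hcB, ?_⟩
    rcases h4 with h4 | h4
    · by_cases hb : b ∈ π'.dropLast ∨ b = f
      · have h5 := h2.concat h4 hbc (hsc c hcB f hfB).to_reflTransGen (hb.imp_right Or.inl)
        exact ⟨π' ++ [c], h1.tail ⟨h2, c, by rwa [N.nextState_of_getLast? h4], rfl⟩, h5,
          ⟨c, hcB, by simp⟩, Or.inl (by simp)⟩
      · push Not at hb
        refine ⟨π', h1, h2, h3, Or.inr ⟨b, hbB, (mem_iff_mem_dropLast_or h4 b).2 (Or.inr rfl), ?_⟩⟩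
        -- If `b` were in `π`, it would be the last state of `π`, hence `f`, or it would have been
        -- left earlier on `π'`. Both are excluded.
        intro hbπ
        rcases Relation.ReflTransGen.cases_tail h1 with rfl | ⟨π'', h6, h7⟩
        · rw [h4] at hf
          exact hb.2 (Option.some.inj hf)
        · obtain ⟨-, w, -, rfl⟩ := h7
          rw [List.dropLast_concat] at hb
          exact hb.1 (SafeStep.subset h6 hbπ)
    · exact ⟨π', h1, h2, h3, Or.inr h4⟩

/-- Each round visits a new state of `B` and returns to `f` along chosen edges, so the number of
unvisited states of `B` drops. Ending at `f` ensures that all other states of `B` have also been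
left. -/
theorem SafePath.exists_extension_cover [Finite V] (hnx : ∀ u, u ≠ f →
      Relation.ReflTransGen (fun a b => N.step a b ≠ 0) u f →
      N.step u (nx u) ≠ 0 ∧ Relation.ReflTransGen (fun a b => N.step a b ≠ 0) (nx u) f ∧
        d (nx u) < d u) {B : Set V} (hB : N.Closed B) (hsc : N.StronglyConnected B)
    (hfB : f ∈ B) (n : ℕ) {π : List V} (h : SafePath N f nx π)
    (hf : π.getLast? = some f) (hn : {u | u ∈ B ∧ u ∉ π}.ncard = n) :
    ∃ π', Relation.ReflTransGen (SafeStep N f nx) π π' ∧ SafePath N f nx π' ∧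
      π'.getLast? = some f ∧ ∀ u ∈ B, u ∈ π' := by
  induction n using Nat.strong_induction_on generalizing π with
  | _ n ih =>
    by_cases hall : ∀ u ∈ B, u ∈ π
    · exact ⟨π, Relation.ReflTransGen.refl, h, hf, hall⟩
    · push Not at hall
      obtain ⟨v, hvB, hvπ⟩ := hall
      obtain ⟨-, π₁, h1, h2, ⟨u, huB, hu⟩, h3⟩ := h.exists_extension_visit hf hB hsc hfB
        (hsc f hfB v hvB).to_reflTransGen
      have h4 : ∃ u ∈ B, u ∈ π₁ ∧ u ∉ π := by
        rcases h3 with h3 | h3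
        · exact ⟨v, hvB, (mem_iff_mem_dropLast_or h3 v).2 (Or.inr rfl), hvπ⟩
        · exact h3
      obtain ⟨π₂, h5, h6, h7⟩ := h2.exists_extension_to hnx _ hu rfl
      have hlt : {u | u ∈ B ∧ u ∉ π₂}.ncard < n := by
        rw [← hn]
        refine Set.ncard_lt_ncard ?_ (Set.toFinite _)
        refine ⟨fun w hw => ⟨hw.1, fun hwπ => hw.2 (SafeStep.subset (h1.trans h5) hwπ)⟩, ?_⟩
        obtain ⟨w, hwB, hw1, hw2⟩ := h4
        intro hsub
        exact (hsub ⟨hwB, hw2⟩ : w ∈ B ∧ w ∉ π₂).2 (SafeStep.subset h5 hw1)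
      obtain ⟨π₃, h8, h9⟩ := ih _ hlt h6 h7 rfl
      exact ⟨π₃, (h1.trans h5).trans h8, h9⟩

/-- All chosen edges of `B` have been taken, so every further step is safe, and `B` is never left.
-/
theorem SafePath.stayProb_eq_one {C : List V → Prop} (hC : ∀ π, SafePath N f nx π → ¬ C π)
    {B : Set V} (hB : N.Closed B) (hsc : N.StronglyConnected B) (hfB : f ∈ B) (n : ℕ)
    {π : List V} (h : SafePath N f nx π) {v : V} (hv : π.getLast? = some v) (hvB : v ∈ B)
    (hcov : ∀ u ∈ B, u = f ∨ u ∈ π.dropLast) : N.stayProb C n π = 1 := by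
  induction n generalizing π v with
  | zero => rfl
  | succ n ih =>
    rw [MarkovChain.stayProb, if_neg (hC π h), N.nextState_of_getLast? hv,
      ← PMF.tsum_coe (N.step v)]
    refine tsum_congr fun w => ?_
    by_cases hw : N.step v w = 0
    · simp [hw]
    · have hwB := hB v hvB w hw
      rw [ih (h.concat hv hw (hsc w hwB f hfB).to_reflTransGen
        ((hcov v hvB).symm.imp_right Or.inl)) (v := w) (by simp) hwB, mul_one]
      intro u hu
      rw [List.dropLast_concat]
      exact (hcov u hu).imp_right List.mem_of_mem_dropLast

/-- If every candidate within the closed strongly connected set `B` that contains `f` is good, then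
with positive probability the path never has a bad candidate. -/
theorem exists_le_stayProb [Finite V] {C : List V → Prop} {good : Set V → Prop}
    (hC : ∀ π, C π → ∃ K, IsCandidate π K ∧ ¬ good K) {B : Set V} (hB : N.Closed B)
    (hsc : N.StronglyConnected B) (hfB : f ∈ B) (hgood : ∀ K, f ∈ K → K ⊆ B → good K) {x₀ : V}
    (hx₀ : N.init x₀ ≠ 0) (hreach : Relation.ReflTransGen (fun a b => N.step a b ≠ 0) x₀ f) :
    ∃ c : ℝ≥0∞, c ≠ 0 ∧ ∀ n, c ≤ N.stayProb C n [] := by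
  obtain ⟨d, nx, hnx⟩ := exists_next (fun a b => N.step a b ≠ 0) f
  have hCs : ∀ π, SafePath N f nx π → ¬ C π := by
    intro π h hCπ
    obtain ⟨K, hK, hKg⟩ := hC π hCπ
    have hfK := h.mem_candidate hnx hK
    exact hKg (hgood K hfK fun u hu =>
      mem_of_closed_of_transGen hB hfB (h.isPath.stronglyConnected hK f hfK u hu))
  have h0 : SafePath N f nx [] := ⟨N.isPath_nil, by simp, by simp⟩
  have h1 : SafePath N f nx [x₀] := by
    refine ⟨?_, by simpa using hreach, by simp⟩
    exact N.isPath_nil.concat (π := []) hx₀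
  obtain ⟨π₁, h2, h3, h4⟩ := h1.exists_extension_to hnx _ rfl rfl
  obtain ⟨π₂, h5, h6, h7, h8⟩ := h3.exists_extension_cover hnx hB hsc hfB _ h4 rfl
  have hstep : SafeStep N f nx [] [x₀] := ⟨h0, x₀, hx₀, rfl⟩
  refine exists_le_stayProb_of_safeStep hCs
    ((Relation.ReflTransGen.single hstep).trans (h2.trans h5)) ⟨1, one_ne_zero, fun n => ?_⟩
  rw [h6.stayProb_eq_one hCs hB hsc hfB n h7 hfB]
  intro u hu
  exact ((mem_iff_mem_dropLast_or h7 u).1 (h8 u hu)).symm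

end Positivity

theorem transGen_step_of_lt {V : Type*} {N : MarkovChain V} {σ : ℕ → V}
    (h : ∀ n, N.step (σ n) (σ (n + 1)) ≠ 0) {n m : ℕ} (hnm : n < m) :
    Relation.TransGen (fun a b => N.step a b ≠ 0) (σ n) (σ m) := by
  induction m, hnm using Nat.le_induction with
  | base => exact Relation.TransGen.single (h n)
  | succ m hm ih => exact ih.tail (h m)

/-- As `p_φ > 0`, some typical run has a good limit set; this is the set `B`, and `f ∈ B` is a state
whose automaton part lies in `F`. A subset of `B` that contains `f` avoids `E` and meets `F`, so it
is good. -/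
theorem LabelledMarkovChain.exists_le_stayProb {S Ap Q : Type*} [Finite S] [Finite Q]
    (M : LabelledMarkovChain S Ap) (D : DRA (Set Ap) Q) (φ : LTL Ap)
    (hD : ∀ w : ℕ → Set Ap, D.Accepts w ↔ φ.Sat w) (hφ : 0 < M.prob φ) (α ε : ℝ) :
    ∃ c : ℝ≥0∞, c ≠ 0 ∧ ∀ n, c ≤ (M.product D).stayProb (ResetCondition D α ε) n [] := by
  have h1 : ∑' x, (M.product D).init x * M.accProb D x ≠ 0 := by
    rw [← M.ofReal_prob φ D hD]
    exact (ENNReal.ofReal_pos.2 hφ).ne'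
  obtain ⟨x₀, hx₀⟩ : ∃ x₀, (M.product D).init x₀ * M.accProb D x₀ ≠ 0 := by
    by_contra hc
    push Not at hc
    exact h1 (by simp [hc])
  have hex : ∃ ω : Run (S × Q), ω 0 = x₀ ∧
      (∀ n, (M.product D).step (ω n) (ω (n + 1)) ≠ 0) ∧
      (∀ u v, (M.product D).step u v ≠ 0 → u ∈ limitSet ω →
        ∃ᶠ n in atTop, ω n = u ∧ ω (n + 1) = v) ∧ D.Good (limitSet ω) := by
    by_contra hc
    refine right_ne_zero_of_mul hx₀ ?_
    have : ∀ᵐ ω : Run (S × Q) ∂(M.product D).law x₀, ¬ D.Good (limitSet ω) := by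
      filter_upwards [(M.product D).law_start x₀, (M.product D).law_ae_step x₀,
        (M.product D).law_ae_recurrent x₀] with ω h1 h2 h3 h4
      exact hc ⟨ω, h1, h2, h3, h4⟩
    rw [ae_iff] at this
    simpa [LabelledMarkovChain.accProb] using this
  obtain ⟨ω, hω0, hstep, hrec, p, hp, hE, f, hf, hF⟩ := hex
  refine _root_.exists_le_stayProb (N := M.product D) (f := f) (good := D.Good)
    (B := limitSet ω) ?_ ((M.product D).closed_limitSet hrec) ?_ hf ?_
    (left_ne_zero_of_mul hx₀) ?_
  · rintro π ⟨⟨K, hK, hKg⟩, -⟩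
    exact ⟨K, candidate_eq_some_iff.1 hK, hKg⟩
  · intro u hu v hv
    obtain ⟨n, rfl⟩ := Frequently.exists hu
    obtain ⟨m, hm, rfl⟩ := frequently_atTop.1 hv (n + 1)
    exact transGen_step_of_lt hstep hm
  · intro K hfK hKB
    exact ⟨p, hp, fun x hx => hE x (hKB hx), f, hfK, hF⟩
  · obtain ⟨m, hm, rfl⟩ := frequently_atTop.1 hf 1
    rw [← hω0]
    exact (transGen_step_of_lt hstep hm).to_reflTransGen

/-! ### Restarting a chain when a condition on its history holds -/

section Restart

variable {V : Type*}

open Classical in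
/-- The chain that extends the current path by one step of `N`, and that resets the path to the
empty one when the condition `C` holds of it. -/
noncomputable def restartChain (N : MarkovChain V) (C : List V → Prop) :
    MarkovChain (List V × ℕ) where
  init := PMF.pure ([], 0)
  step := fun x =>
    if C x.1 then PMF.pure ([], x.2 + 1)
    else (N.nextState x.1).map fun v => (x.1 ++ [v], x.2)

variable {N : MarkovChain V} {C : List V → Prop}

theorem restartChain_step_of_pos {π : List V} (r : ℕ) (h : C π) :
    (restartChain N C).step (π, r) = PMF.pure ([], r + 1) := if_pos h

theorem restartChain_step_of_neg {π : List V} (r : ℕ) (h : ¬ C π) :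
    (restartChain N C).step (π, r) = (N.nextState π).map fun v => (π ++ [v], r) := if_neg h

theorem tsum_restartChain_step_of_pos {π : List V} (r : ℕ) (h : C π)
    (G : List V × ℕ → ℝ≥0∞) : ∑' y, (restartChain N C).step (π, r) y * G y = G ([], r + 1) := by
  classical
  rw [restartChain_step_of_pos r h, tsum_eq_single ([], r + 1)]
  · simp
  · intro y hy
    simp [PMF.pure_apply, hy]

theorem tsum_restartChain_step_of_neg {π : List V} (r : ℕ) (h : ¬ C π)
    (G : List V × ℕ → ℝ≥0∞) : ∑' y, (restartChain N C).step (π, r) y * G y =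
      ∑' v, N.nextState π v * G (π ++ [v], r) := by
  rw [restartChain_step_of_neg r h, PMF.tsum_map_mul]

theorem restartChain_step_ne_zero {x y : List V × ℕ} (h : (restartChain N C).step x y ≠ 0) :
    (C x.1 ∧ y.1 = [] ∧ y.2 = x.2 + 1) ∨
      (¬ C x.1 ∧ y.2 = x.2 ∧ ∃ v, N.nextState x.1 v ≠ 0 ∧ y.1 = x.1 ++ [v]) := by
  obtain ⟨π, r⟩ := x
  rw [← PMF.mem_support_iff] at h
  by_cases hC : C π
  · rw [restartChain_step_of_pos r hC, PMF.support_pure, Set.mem_singleton_iff] at h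
    subst h
    exact Or.inl ⟨hC, rfl, rfl⟩
  · rw [restartChain_step_of_neg r hC, PMF.support_map] at h
    obtain ⟨v, hv, rfl⟩ := h
    exact Or.inr ⟨hC, rfl, v, hv, rfl⟩

theorem resets_eq_coe_iff {ρ : Run (List V × ℕ)} {k : ℕ} :
    resets ρ = k ↔ (∀ n, (ρ n).2 ≤ k) ∧ ∃ n, (ρ n).2 = k := by
  have hle : ∀ k : ℕ, resets ρ ≤ k ↔ ∀ n, (ρ n).2 ≤ k := by
    intro k
    simp [resets]
  constructor
  · intro h
    have h1 := (hle k).1 h.le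
    refine ⟨h1, ?_⟩
    by_contra hc
    push Not at hc
    cases k with
    | zero => exact hc 0 (Nat.le_zero.1 (h1 0))
    | succ k =>
      have h2 : resets ρ ≤ (k : ℕ∞) := (hle k).2 fun n => by
        have := h1 n; have := hc n; omega
      rw [h] at h2
      have := ENat.natCast_le_natCast.1 h2
      omega
  · rintro ⟨h1, n, hn⟩
    refine le_antisymm ((hle k).2 h1) ?_
    rw [← hn]
    exact le_iSup (fun n => ((ρ n).2 : ℕ∞)) n

theorem measurableSet_forall_snd [Countable V] (p : ℕ → ℕ → Prop) :
    MeasurableSet {ρ : Run (List V × ℕ) | ∀ n, p n (ρ n).2} := by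
  have : {ρ : Run (List V × ℕ) | ∀ n, p n (ρ n).2} =
      ⋂ n : ℕ, {ρ : Run (List V × ℕ) | ρ n ∈ {x | p n x.2}} := by
    ext ρ; simp
  rw [this]
  exact MeasurableSet.iInter fun n => Run.measurableSet_coord n _

theorem measurableSet_resets_eq [Countable V] (k : ℕ) :
    MeasurableSet {ρ : Run (List V × ℕ) | resets ρ = k} := by
  have : {ρ : Run (List V × ℕ) | resets ρ = k} =
      {ρ | ∀ n, (ρ n).2 ≤ k} ∩ {ρ | ∀ n, (ρ n).2 ≠ k}ᶜ := by
    ext ρ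
    simp [resets_eq_coe_iff]
  rw [this]
  exact (measurableSet_forall_snd fun _ a => a ≤ k).inter
    (measurableSet_forall_snd fun _ a => a ≠ k).compl

theorem resets_cons_eq_iff {π : List V} {r m : ℕ} (h : r < m) (ρ : Run (List V × ℕ)) :
    resets (Run.cons (π, r) ρ) = m ↔ resets ρ = m := by
  rw [resets_eq_coe_iff, resets_eq_coe_iff]
  constructor
  · rintro ⟨h1, n, hn⟩
    refine ⟨fun n => h1 (n + 1), ?_⟩
    cases n with
    | zero => exact absurd hn h.ne
    | succ n => exact ⟨n, hn⟩
  · rintro ⟨h1, n, hn⟩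
    refine ⟨fun n => ?_, n + 1, hn⟩
    cases n with
    | zero => exact h.le
    | succ n => exact h1 n

variable [Countable V]

theorem restartChain_law_stay (n : ℕ) (π : List V) (r : ℕ) :
    (restartChain N C).law (π, r) {ρ | ∀ j, j ≤ n → (ρ j).2 = r} = N.stayProb C n π := by
  have hm : ∀ n r, MeasurableSet {ρ : Run (List V × ℕ) | ∀ j, j ≤ n → (ρ j).2 = r} :=
    fun n r => measurableSet_forall_snd fun j a => j ≤ n → a = r
  induction n generalizing π with
  | zero =>
    refine (prob_compl_eq_zero_iff (hm 0 r)).1 ?_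
    refine measure_mono_null ?_ (ae_iff.1 ((restartChain N C).law_start (π, r)))
    intro ρ hρ h
    refine hρ fun j hj => ?_
    obtain rfl : j = 0 := by omega
    rw [h]
  | succ n ih =>
    have hpre : Run.cons (π, r) ⁻¹' {ρ : Run (List V × ℕ) | ∀ j, j ≤ n + 1 → (ρ j).2 = r} =
        {ρ | ∀ j, j ≤ n → (ρ j).2 = r} := by
      ext ρ
      constructor
      · intro h j hj
        exact h (j + 1) (by omega)
      · intro h j hj
        cases j with
        | zero => rfl
        | succ j => exact h j (by omega)
    rw [MarkovChain.law_apply _ _ (hm _ _), hpre, MarkovChain.stayProb]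
    by_cases hC : C π
    · rw [if_pos hC, tsum_restartChain_step_of_pos r hC]
      refine measure_mono_null ?_ (ae_iff.1 ((restartChain N C).law_start ([], r + 1)))
      intro ρ h1 h2
      have h3 := h1 0 (Nat.zero_le _)
      rw [h2] at h3
      simp at h3
    · rw [if_neg hC, tsum_restartChain_step_of_neg r hC]
      exact tsum_congr fun v => by rw [ih]

theorem tendsto_stayProb (π : List V) (r : ℕ) :
    Tendsto (fun n => N.stayProb C n π) atTop
      (nhds ((restartChain N C).law (π, r) {ρ | ∀ j, (ρ j).2 = r})) := by
  simp_rw [← restartChain_law_stay (N := N) (C := C) _ π r]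
  have h1 : {ρ : Run (List V × ℕ) | ∀ j, (ρ j).2 = r} =
      ⋂ n : ℕ, {ρ : Run (List V × ℕ) | ∀ j, j ≤ n → (ρ j).2 = r} := by
    ext ρ
    simp only [Set.mem_ofPred_eq, Set.mem_iInter]
    exact ⟨fun h n j _ => h j, fun h j => h j j le_rfl⟩
  rw [h1]
  refine tendsto_measure_iInter_atTop (fun n => ?_) ?_ ⟨0, measure_ne_top _ _⟩
  · exact (measurableSet_forall_snd fun j a => j ≤ n → a = r).nullMeasurableSet
  · intro n m hnm ρ hρ j hj
    exact hρ j (hj.trans hnm)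

theorem restartChain_ae_le_snd (π : List V) (r : ℕ) :
    ∀ᵐ ρ ∂(restartChain N C).law (π, r), ∀ n, r ≤ (ρ n).2 := by
  filter_upwards [(restartChain N C).law_start (π, r), (restartChain N C).law_ae_step (π, r)]
    with ρ h0 h1 n
  induction n with
  | zero => rw [h0]
  | succ n ih =>
    rcases restartChain_step_ne_zero (h1 n) with ⟨-, -, h⟩ | ⟨-, h, -⟩ <;> omega

theorem restartChain_law_resets_zero (π : List V) (r : ℕ) :
    (restartChain N C).law (π, r) {ρ | resets ρ = r} =
      (restartChain N C).law (π, r) {ρ | ∀ j, (ρ j).2 = r} := by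
  refine measure_congr ?_
  filter_upwards [restartChain_ae_le_snd (N := N) (C := C) π r] with ρ h
  refine propext ⟨fun h1 j => ?_, fun h1 => ?_⟩
  · exact le_antisymm ((resets_eq_coe_iff.1 h1).1 j) (h j)
  · exact resets_eq_coe_iff.2 ⟨fun n => (h1 n).le, 0, h1 0⟩

/-- With `G` the probability after a fresh start, the reset by time `n` contributes `(1 - stayProb
n) * G`, as the chain starts afresh from it. The additive form avoids subtraction in `ℝ≥0∞` and
passes directly through the induction on `n`. -/
theorem restartChain_law_resets_succ_aux (n : ℕ) (π : List V) (r k : ℕ) :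
    (restartChain N C).law (π, r)
        ({ρ | ∃ j, j ≤ n ∧ (ρ j).2 ≠ r} ∩ {ρ | resets ρ = (r + 1 + k : ℕ)}) +
      N.stayProb C n π *
        (restartChain N C).law ([], r + 1) {ρ | resets ρ = (r + 1 + k : ℕ)} =
    (restartChain N C).law ([], r + 1) {ρ | resets ρ = (r + 1 + k : ℕ)} := by
  have hm : ∀ n, MeasurableSet {ρ : Run (List V × ℕ) | ∃ j, j ≤ n ∧ (ρ j).2 ≠ r} := by
    intro n
    have : {ρ : Run (List V × ℕ) | ∃ j, j ≤ n ∧ (ρ j).2 ≠ r} =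
        {ρ | ∀ j, j ≤ n → (ρ j).2 = r}ᶜ := by
      ext ρ; simp
    rw [this]
    exact (measurableSet_forall_snd fun j a => j ≤ n → a = r).compl
  set E : Set (Run (List V × ℕ)) := {ρ | resets ρ = (r + 1 + k : ℕ)} with hE
  set G := (restartChain N C).law ([], r + 1) E with hG
  induction n generalizing π with
  | zero =>
    have : (restartChain N C).law (π, r) ({ρ | ∃ j, j ≤ 0 ∧ (ρ j).2 ≠ r} ∩ E) = 0 := by
      refine measure_mono_null ?_ (ae_iff.1 ((restartChain N C).law_start (π, r)))
      rintro ρ ⟨⟨j, hj, h⟩, -⟩ h0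
      obtain rfl : j = 0 := by omega
      exact h (by rw [h0])
    rw [this, MarkovChain.stayProb, zero_add, one_mul]
  | succ n ih =>
    have hpre : Run.cons (π, r) ⁻¹' ({ρ | ∃ j, j ≤ n + 1 ∧ (ρ j).2 ≠ r} ∩ E) =
        {ρ | ∃ j, j ≤ n ∧ (ρ j).2 ≠ r} ∩ E := by
      ext ρ
      refine and_congr ?_ (resets_cons_eq_iff (by omega) ρ)
      constructor
      · rintro ⟨j, hj, h⟩
        cases j with
        | zero => exact absurd rfl h
        | succ j => exact ⟨j, by omega, h⟩
      · rintro ⟨j, hj, h⟩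
        exact ⟨j + 1, by omega, h⟩
    rw [MarkovChain.law_apply _ _ ((hm _).inter (measurableSet_resets_eq _)), hpre,
      MarkovChain.stayProb]
    by_cases hC : C π
    · rw [if_pos hC, tsum_restartChain_step_of_pos r hC, zero_mul, add_zero]
      refine measure_congr ?_
      filter_upwards [(restartChain N C).law_start ([], r + 1)] with ρ h0
      refine propext ⟨fun h => h.2, fun h => ⟨⟨0, Nat.zero_le _, ?_⟩, h⟩⟩
      rw [h0]
      simp
    · rw [if_neg hC, tsum_restartChain_step_of_neg r hC, ← ENNReal.tsum_mul_right,
        ← ENNReal.tsum_add]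
      calc _ = ∑' v, N.nextState π v * G := by
            refine tsum_congr fun v => ?_
            rw [mul_assoc, ← mul_add, ih]
        _ = G := by rw [ENNReal.tsum_mul_right, PMF.tsum_coe, one_mul]

theorem restartChain_law_resets_succ (π : List V) (r k : ℕ) :
    (restartChain N C).law (π, r) {ρ | resets ρ = (r + 1 + k : ℕ)} +
      (restartChain N C).law (π, r) {ρ | ∀ j, (ρ j).2 = r} *
        (restartChain N C).law ([], r + 1) {ρ | resets ρ = (r + 1 + k : ℕ)} =
    (restartChain N C).law ([], r + 1) {ρ | resets ρ = (r + 1 + k : ℕ)} := by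
  have h1 : {ρ : Run (List V × ℕ) | resets ρ = (r + 1 + k : ℕ)} =
      ⋃ n : ℕ, {ρ | ∃ j, j ≤ n ∧ (ρ j).2 ≠ r} ∩ {ρ | resets ρ = (r + 1 + k : ℕ)} := by
    rw [← Set.iUnion_inter]
    refine (Set.inter_eq_right.2 fun ρ hρ => ?_).symm
    obtain ⟨-, n, hn⟩ := resets_eq_coe_iff.1 hρ
    exact Set.mem_iUnion.2 ⟨n, n, le_rfl, by omega⟩
  have h2 : Tendsto (fun n => (restartChain N C).law (π, r)
      ({ρ | ∃ j, j ≤ n ∧ (ρ j).2 ≠ r} ∩ {ρ | resets ρ = (r + 1 + k : ℕ)})) atTop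
      (nhds ((restartChain N C).law (π, r) {ρ | resets ρ = (r + 1 + k : ℕ)})) := by
    conv => rhs; rw [h1]
    refine tendsto_measure_iUnion_atTop ?_
    rintro n m hnm ρ ⟨⟨j, hj, h⟩, h'⟩
    exact ⟨⟨j, hj.trans hnm, h⟩, h'⟩
  have h3 := h2.add (ENNReal.Tendsto.mul_const (tendsto_stayProb (N := N) (C := C) π r)
    (Or.inr (measure_ne_top ((restartChain N C).law ([], r + 1))
      {ρ | resets ρ = (r + 1 + k : ℕ)})))
  simp_rw [restartChain_law_resets_succ_aux] at h3
  exact tendsto_nhds_unique h3 tendsto_const_nhds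

/-- The number of resets is geometrically distributed. -/
theorem restartChain_law_resets {p : ℝ} (hp0 : 0 ≤ p) (hp1 : p ≤ 1)
    (hp : (restartChain N C).law ([], 0) {ρ | ∀ j, (ρ j).2 = 0} = ENNReal.ofReal p) (k r : ℕ) :
    (restartChain N C).law ([], r) {ρ | resets ρ = (r + k : ℕ)} =
      ENNReal.ofReal ((1 - p) ^ k * p) := by
  -- The probability of no further reset does not depend on the counter: for every `r` it is the
  -- limit of the same sequence `stayProb n []`.
  have hstay : ∀ r, (restartChain N C).law ([], r) {ρ | ∀ j, (ρ j).2 = r} =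
      ENNReal.ofReal p := fun r =>
    (tendsto_nhds_unique (tendsto_stayProb [] r) (tendsto_stayProb [] 0)).trans hp
  induction k generalizing r with
  | zero => rw [add_zero, restartChain_law_resets_zero, hstay, pow_zero, one_mul]
  | succ k ih =>
    have h1 := restartChain_law_resets_succ (N := N) (C := C) [] r k
    rw [hstay, ih (r + 1), ← ENNReal.ofReal_mul hp0] at h1
    have hx : 0 ≤ (1 - p) ^ k * p := mul_nonneg (pow_nonneg (by linarith) _) hp0
    rw [show r + (k + 1) = r + 1 + k by omega]
    rw [ENNReal.eq_sub_of_add_eq ENNReal.ofReal_ne_top h1,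
      ← ENNReal.ofReal_sub _ (mul_nonneg hp0 hx)]
    congr 1
    ring

end Restart

/-! ### Geometric random variables -/

theorem setOf_lt_top_eq_iUnion {Ω : Type*} (R : Ω → ℕ∞) :
    {ω | R ω < ⊤} = ⋃ k : ℕ, {ω | R ω = k} := by
  ext ω
  simp only [Set.mem_ofPred_eq, Set.mem_iUnion]
  rw [lt_top_iff_ne_top, ENat.ne_top_iff_exists]
  exact exists_congr fun k => eq_comm

theorem measurableSet_lt_top {Ω : Type*} [MeasurableSpace Ω] {R : Ω → ℕ∞}
    (hm : ∀ k : ℕ, MeasurableSet {ω | R ω = k}) : MeasurableSet {ω | R ω < ⊤} := by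
  rw [setOf_lt_top_eq_iUnion]
  exact MeasurableSet.iUnion hm

section Geometric

variable {Ω : Type*} [MeasurableSpace Ω] {μ : Measure Ω} {R : Ω → ℕ∞} {p : ℝ}

theorem measure_lt_top_of_geometric (hm : ∀ k : ℕ, MeasurableSet {ω | R ω = k}) (hp0 : 0 < p)
    (hp1 : p ≤ 1) (h : ∀ k : ℕ, μ {ω | R ω = k} = ENNReal.ofReal ((1 - p) ^ k * p)) :
    μ {ω | R ω < ⊤} = 1 := by
  have hs := summable_geometric_of_lt_one (r := 1 - p) (by linarith) (by linarith)
  rw [setOf_lt_top_eq_iUnion, measure_iUnion _ hm]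
  · simp_rw [h]
    rw [← ENNReal.ofReal_tsum_of_nonneg
      (fun k => mul_nonneg (pow_nonneg (by linarith) _) hp0.le) (hs.mul_right p),
      tsum_mul_right, tsum_geometric_of_lt_one (by linarith) (by linarith), sub_sub_cancel,
      inv_mul_cancel₀ hp0.ne', ENNReal.ofReal_one]
  · intro i j hij
    rw [Function.onFun, Set.disjoint_left]
    intro ω h1 h2
    exact hij (ENat.natCast_inj.1 (h1.symm.trans h2))

theorem lintegral_of_geometric [IsProbabilityMeasure μ]
    (hm : ∀ k : ℕ, MeasurableSet {ω | R ω = k}) (hp0 : 0 < p)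
    (hp1 : p ≤ 1) (h : ∀ k : ℕ, μ {ω | R ω = k} = ENNReal.ofReal ((1 - p) ^ k * p)) :
    ∫⁻ ω, (R ω : ℝ≥0∞) ∂μ = ENNReal.ofReal ((1 - p) / p) := by
  have hae : ∀ᵐ ω ∂μ, R ω < ⊤ := by
    rw [ae_iff]
    exact (prob_compl_eq_zero_iff (measurableSet_lt_top hm)).2 (measure_lt_top_of_geometric hm hp0 hp1 h)
  -- Since `R` is almost surely finite, it is the sum of its values times the indicators of its
  -- level sets.
  have h1 : ∫⁻ ω, (R ω : ℝ≥0∞) ∂μ =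
      ∫⁻ ω, ∑' k : ℕ, ({ω | R ω = k} : Set Ω).indicator (fun _ => (k : ℝ≥0∞)) ω ∂μ := by
    refine lintegral_congr_ae ?_
    filter_upwards [hae] with ω hω
    obtain ⟨k, hk⟩ := ENat.ne_top_iff_exists.1 hω.ne
    rw [tsum_eq_single k]
    · rw [Set.indicator_of_mem (show ω ∈ {ω | R ω = k} from hk.symm), ← hk]
      simp
    · intro j hj
      refine Set.indicator_of_notMem (fun hj' => hj ?_) _
      exact ENat.natCast_inj.1 ((show R ω = j from hj').symm.trans hk.symm)
  rw [h1, lintegral_tsum fun k => (measurable_const.indicator (hm k)).aemeasurable]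
  simp_rw [lintegral_indicator_const (hm _), h, ← ENNReal.ofReal_natCast]
  have hr : ‖1 - p‖ < 1 := by rw [Real.norm_eq_abs, abs_lt]; constructor <;> linarith
  have hsum := hasSum_coe_mul_geometric_of_norm_lt_one hr
  have hsum' := hsum.mul_right p
  have hnn : ∀ k : ℕ, 0 ≤ (k : ℝ) * (1 - p) ^ k * p := fun k =>
    mul_nonneg (mul_nonneg (Nat.cast_nonneg _) (pow_nonneg (by linarith) _)) hp0.le
  calc ∑' k : ℕ, ENNReal.ofReal (k : ℝ) * ENNReal.ofReal ((1 - p) ^ k * p)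
      = ∑' k : ℕ, ENNReal.ofReal ((k : ℝ) * (1 - p) ^ k * p) := by
        refine tsum_congr fun k => ?_
        rw [← ENNReal.ofReal_mul (Nat.cast_nonneg _), mul_assoc]
    _ = ENNReal.ofReal ((1 - p) / p) := by
        rw [← ENNReal.ofReal_tsum_of_nonneg hnn hsum'.summable, hsum'.tsum_eq]
        congr 1
        rw [sub_sub_cancel]
        field_simp

end Geometric

/-! ### The run after the last reset -/

section LastRun

variable {V : Type*} {N : MarkovChain V} {C : List V → Prop}

/-- Whatever the path before it, an occurrence of `u` at its end without a reset is followed by `v`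
with the same probability. This uniform bound is what `law_ae_frequently` needs, although no pair of
path and counter occurs twice. -/
theorem restartChain_ae_recurrent [Countable V] (x : List V × ℕ) :
    ∀ᵐ ρ : Run (List V × ℕ) ∂(restartChain N C).law x, ∀ u v, N.step u v ≠ 0 →
      (∃ᶠ n in atTop, (ρ n).1.getLast? = some u ∧ ¬ C (ρ n).1) →
      ∃ᶠ n in atTop, ((ρ n).1.getLast? = some u ∧ ¬ C (ρ n).1) ∧
        (ρ (n + 1)).1.getLast? = some v := by
  classical
  rw [ae_all_iff]; intro u
  rw [ae_all_iff]; intro v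
  by_cases huv : N.step u v = 0
  · exact Eventually.of_forall fun ρ h => absurd huv h
  · have hY : ∀ y ∈ {y : List V × ℕ | y.1.getLast? = some u ∧ ¬ C y.1},
        ∃ y' ∈ {y : List V × ℕ | y.1.getLast? = some v},
          N.step u v ≤ (restartChain N C).step y y' := by
      rintro ⟨π, r⟩ ⟨h1, h2⟩
      refine ⟨(π ++ [v], r), by simp, ?_⟩
      rw [restartChain_step_of_neg r h2, N.nextState_of_getLast? h1, PMF.map_apply]
      refine le_trans ?_ (ENNReal.le_tsum v)
      rw [if_pos rfl]
    filter_upwards [(restartChain N C).law_ae_frequently huv hY x] with ρ hρ _ h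
    exact hρ h

theorem exists_lastRun {ρ : Run (List V × ℕ)} (h0 : ρ 0 = ([], 0))
    (hstep : ∀ n, (restartChain N C).step (ρ n) (ρ (n + 1)) ≠ 0) (hfin : resets ρ < ⊤) :
    ∃ n, IsLastStart ρ n ∧ ∃ σ : ℕ → V, (∀ k, (ρ (n + k)).1 = (List.range k).map σ) ∧
      (∀ k, ¬ C (ρ (n + k)).1) ∧ N.init (σ 0) ≠ 0 ∧ ∀ k, N.step (σ k) (σ (k + 1)) ≠ 0 := by
  classical
  obtain ⟨r, hr⟩ := ENat.ne_top_iff_exists.1 hfin.ne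
  obtain ⟨hle, hex⟩ := resets_eq_coe_iff.1 hr.symm
  have hmono : ∀ n m, n ≤ m → (ρ n).2 ≤ (ρ m).2 := by
    intro n m hnm
    induction m, hnm using Nat.le_induction with
    | base => exact le_rfl
    | succ m _ ih =>
      rcases restartChain_step_ne_zero (hstep m) with ⟨-, -, h⟩ | ⟨-, h, -⟩ <;> omega
  -- The first time at which the monotone counter has its final value is the start of the last
  -- execution.
  set n := Nat.find hex with hn
  have hnr : (ρ n).2 = r := Nat.find_spec hex
  have hconst : ∀ m, n ≤ m → (ρ m).2 = r := fun m hm =>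
    le_antisymm (hle m) (hnr ▸ hmono n m hm)
  have hstart : (ρ n).1 = [] ∧ (n = 0 ∨ (ρ (n - 1)).2 ≠ (ρ n).2) := by
    cases hn' : n with
    | zero => exact ⟨by rw [h0], Or.inl rfl⟩
    | succ m =>
      have hm : (ρ m).2 ≠ r := Nat.find_min hex (by omega)
      rw [hn'] at hnr
      refine ⟨?_, Or.inr (by rw [hnr]; exact hm)⟩
      rcases restartChain_step_ne_zero (hstep m) with ⟨-, h, -⟩ | ⟨-, h, -⟩
      · exact h
      · exact absurd (h.symm.trans hnr) hm
  have hnext : ∀ k, ¬ C (ρ (n + k)).1 ∧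
      ∃ v, N.nextState (ρ (n + k)).1 v ≠ 0 ∧ (ρ (n + (k + 1))).1 = (ρ (n + k)).1 ++ [v] := by
    intro k
    have h1 := hconst (n + k) (by omega)
    have h2 := hconst (n + k + 1) (by omega)
    rcases restartChain_step_ne_zero (hstep (n + k)) with ⟨-, -, h⟩ | ⟨h, -, h'⟩
    · omega
    · exact ⟨h, h'⟩
  choose hC σ hσ1 hσ2 using hnext
  have hpath : ∀ k, (ρ (n + k)).1 = (List.range k).map σ := by
    intro k
    induction k with
    | zero => simpa using hstart.1
    | succ k ih =>
      rw [hσ2, ih, List.range_succ]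
      simp
  refine ⟨n, ⟨fun m hm => (hconst m hm).trans hnr.symm, hstart.2⟩, σ, hpath, hC, ?_, fun k => ?_⟩
  · have := hσ1 0
    rwa [hpath 0] at this
  · have := hσ1 (k + 1)
    rwa [N.nextState_of_getLast? (v := σ k) (by rw [hpath, List.range_succ]; simp)] at this

/-- After position `n` the path grows by one state per step, and the path at position `n + (k + 1)`
ends in `σ k`. Recurrence in the monitor thus becomes recurrence in `σ`. -/
theorem recurrent_lastRun {ρ : Run (List V × ℕ)} {n : ℕ} {σ : ℕ → V}
    (hpath : ∀ k, (ρ (n + k)).1 = (List.range k).map σ) (hC : ∀ k, ¬ C (ρ (n + k)).1) {u v : V}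
    (h : (∃ᶠ n in atTop, (ρ n).1.getLast? = some u ∧ ¬ C (ρ n).1) →
      ∃ᶠ n in atTop, ((ρ n).1.getLast? = some u ∧ ¬ C (ρ n).1) ∧
        (ρ (n + 1)).1.getLast? = some v) (hu : u ∈ limitSet σ) :
    ∃ᶠ k in atTop, σ k = u ∧ σ (k + 1) = v := by
  have hlast : ∀ k, (ρ (n + (k + 1))).1.getLast? = some (σ k) := by
    intro k
    rw [hpath, List.range_succ]
    simp
  have h1 : ∃ᶠ n in atTop, (ρ n).1.getLast? = some u ∧ ¬ C (ρ n).1 := by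
    rw [frequently_atTop]
    intro a
    obtain ⟨k, hk, rfl⟩ := frequently_atTop.1 hu a
    exact ⟨n + (k + 1), by omega, hlast k, hC _⟩
  rw [frequently_atTop]
  intro a
  obtain ⟨m, hm, ⟨h2, -⟩, h3⟩ := frequently_atTop.1 (h h1) (n + (a + 1))
  obtain ⟨d, rfl⟩ := Nat.exists_eq_add_of_le hm
  refine ⟨a + d, by omega, ?_, ?_⟩
  · rw [show n + (a + 1) + d = n + (a + d + 1) by omega, hlast] at h2
    exact Option.some.inj h2
  · rw [show n + (a + 1) + d + 1 = n + (a + d + 1 + 1) by omega, hlast] at h3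
    exact Option.some.inj h3

end LastRun

section Monitor

variable {S Ap Q : Type*} (M : LabelledMarkovChain S Ap) (D : DRA (Set Ap) Q)

theorem boldMonitor_runMeasure (α ε : ℝ) : (boldMonitor M D α ε).runMeasure =
    (restartChain (M.product D) (ResetCondition D α ε)).law ([], 0) := rfl


theorem LabelledMarkovChain.snd_eq_run {σ : ℕ → S × Q} (h0 : (M.product D).init (σ 0) ≠ 0)
    (hstep : ∀ k, (M.product D).step (σ k) (σ (k + 1)) ≠ 0) (n : ℕ) :
    (σ n).2 = D.run (fun k => M.label (σ k).1) (n + 1) := by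
  induction n with
  | zero => exact M.product_init_ne_zero D h0
  | succ n ih =>
    rw [((M.product_step_ne_zero_iff D _ _).1 (hstep n)).1, ih]
    rfl

variable [Finite S] [Finite Q]

/-- A bad limit set would be the candidate with a fixed index and unbounded strength, and so pass
its threshold at some time. -/
theorem good_limitSet_of_forall_not_resetCondition {α ε : ℝ} {σ : ℕ → S × Q}
    (hstep : ∀ k, (M.product D).step (σ k) (σ (k + 1)) ≠ 0)
    (hcl : (M.product D).Closed (limitSet σ))
    (hC : ∀ k, ¬ ResetCondition D α ε ((List.range k).map σ)) : D.Good (limitSet σ) := by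
  by_contra hbad
  obtain ⟨i, hi⟩ := exists_strength_ge hstep hcl
  obtain ⟨k, h1, h2, h3⟩ := hi ⌈α * ((i : ℝ) - Real.logb 2 ε)⌉₊
  refine hC k ⟨⟨_, candidate_eq_some_iff.2 h1, hbad⟩, ?_⟩
  rw [h2]
  exact Nat.ceil_le.1 h3

theorem boldMonitor_ae_finalRunSatisfies (φ : LTL Ap)
    (hD : ∀ w : ℕ → Set Ap, D.Accepts w ↔ φ.Sat w) (α ε : ℝ)
    (hfin : ∀ᵐ ρ ∂(boldMonitor M D α ε).runMeasure, resets ρ < ⊤) :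
    ∀ᵐ ρ ∂(boldMonitor M D α ε).runMeasure, ρ ∈ finalRunSatisfies Q M φ := by
  rw [boldMonitor_runMeasure] at *
  filter_upwards [hfin, MarkovChain.law_start _ _, MarkovChain.law_ae_step _ _,
    restartChain_ae_recurrent _] with ρ h1 h2 h3 h4
  obtain ⟨n, hn, σ, hpath, hC, hinit, hstep⟩ := exists_lastRun h2 h3 h1
  refine ⟨h1, n, hn, σ, hpath, ?_⟩
  have hcl := (M.product D).closed_limitSet fun u v huv hu =>
    recurrent_lastRun hpath hC (h4 u v huv) hu
  have hgood := good_limitSet_of_forall_not_resetCondition M D hstep hcl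
    (α := α) (ε := ε) fun k => by rw [← hpath]; exact hC k
  exact (hD _).1 ((D.accepts_iff_good_limitSet _ σ (M.snd_eq_run D hinit hstep)).2 hgood)

end Monitor

/-! ### Assembly of the theorem -/

theorem mainTheorem2 {S Ap Q : Type*} [Finite S] [Finite Ap] [Finite Q]
    (M : LabelledMarkovChain S Ap) (φ : LTL Ap) (D : DRA (Set Ap) Q)
    (hD : ∀ w : ℕ → Set Ap, D.Accepts w ↔ φ.Sat w)
    (hφ : 0 < M.prob φ) (α ε : ℝ) (hα : M.alpha0 ≤ α) (hε : 0 < ε) :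
    -- the number of resets is geometrically distributed
    (∃ p : ℝ, 0 < p ∧ p ≤ 1 ∧ M.prob φ * (1 - ε) ≤ p ∧
      ∀ k : ℕ, (boldMonitor M D α ε).runMeasure {ρ | resets ρ = k} =
        ENNReal.ofReal ((1 - p) ^ k * p)) ∧
    -- it is almost surely finite, and its expectation is bounded
    (boldMonitor M D α ε).runMeasure {ρ | resets ρ < ⊤} = 1 ∧
    (ε < 1 → ∫⁻ ρ, (resets ρ : ℝ≥0∞) ∂(boldMonitor M D α ε).runMeasure ≤
      ENNReal.ofReal (1 / (M.prob φ * (1 - ε)))) ∧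
    -- the run after the last reset satisfies the formula almost surely
    (∀ᵐ ρ ∂(boldMonitor M D α ε).runMeasure, ρ ∈ finalRunSatisfies Q M φ) ∧
    cond (boldMonitor M D α ε).runMeasure {ρ | resets ρ < ⊤} (finalRunSatisfies Q M φ) =
      (boldMonitor M D α ε).runMeasure (finalRunSatisfies Q M φ) ∧
    (boldMonitor M D α ε).runMeasure (finalRunSatisfies Q M φ) = 1
  := by
  set μ := (boldMonitor M D α ε).runMeasure with hμ
  have hlaw : μ = (restartChain (M.product D) (ResetCondition D α ε)).law ([], 0) := rfl
  have hprob : IsProbabilityMeasure μ := MarkovChain.runMeasure_isProbabilityMeasure _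
  set P := (restartChain (M.product D) (ResetCondition D α ε)).law ([], 0)
    {ρ | ∀ j, (ρ j).2 = 0} with hP
  have hP1 : P ≤ 1 := prob_le_one
  have hPt : P ≠ ∞ := (hP1.trans_lt ENNReal.one_lt_top).ne
  have hlim := tendsto_stayProb (N := M.product D) (C := ResetCondition D α ε) [] 0
  -- Positivity needs its own argument, because `p_φ (1 - ε)` need not be positive.
  have hpos : 0 < P.toReal := by
    obtain ⟨c, hc, hcn⟩ := M.exists_le_stayProb D φ hD hφ α ε
    exact ENNReal.toReal_pos
      ((pos_iff_ne_zero.2 hc).trans_le (ge_of_tendsto' hlim hcn)).ne' hPt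
  have hle1 : P.toReal ≤ 1 := ENNReal.toReal_mono ENNReal.one_ne_top hP1
  have hbound : M.prob φ * (1 - ε) ≤ P.toReal := (ENNReal.ofReal_le_iff_le_toReal hPt).1
    (ge_of_tendsto' hlim (M.prob_mul_one_sub_le_stayProb D φ hD hα hε))
  have hgeo : ∀ k : ℕ, μ {ρ | resets ρ = k} =
      ENNReal.ofReal ((1 - P.toReal) ^ k * P.toReal) := by
    intro k
    have := restartChain_law_resets (N := M.product D) (C := ResetCondition D α ε) hpos.le hle1
      (ENNReal.ofReal_toReal hPt).symm k 0
    rwa [zero_add] at this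
  have hfin := measure_lt_top_of_geometric (fun k => measurableSet_resets_eq k) hpos hle1 hgeo
  have hmfin : MeasurableSet {ρ : Run (List (S × Q) × ℕ) | resets ρ < ⊤} :=
    measurableSet_lt_top fun k => measurableSet_resets_eq k
  have hae : ∀ᵐ ρ ∂μ, resets ρ < ⊤ := by
    rw [ae_iff]
    exact (prob_compl_eq_zero_iff hmfin).2 hfin
  have hsat := boldMonitor_ae_finalRunSatisfies M D φ hD α ε hae
  have hone : μ (finalRunSatisfies Q M φ) = 1 := by
    -- Measurability of the event is not needed, as its complement is a null set.
    rw [measure_eq_measure_of_null_sdiff (Set.subset_univ _), measure_univ]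
    rw [← Set.compl_eq_univ_sdiff]
    exact hsat
  refine ⟨⟨P.toReal, hpos, hle1, hbound, hgeo⟩, hfin, fun hε1 => ?_, hsat, ?_, hone⟩
  -- The expectation is `(1 - p) / p`, since `R` counts failures only; the claim needs just `1 - p ≤
  -- 1` and the lower bound for `p`.
  · rw [lintegral_of_geometric (fun k => measurableSet_resets_eq k) hpos hle1 hgeo]
    refine ENNReal.ofReal_le_ofReal ?_
    have h1 : 0 < M.prob φ * (1 - ε) := mul_pos hφ (by linarith)
    exact div_le_div₀ zero_le_one (by linarith) h1 hbound
  · rw [cond_apply hmfin, hfin, inv_one, one_mul]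
    congr 1
    exact Set.inter_eq_right.2 fun ρ hρ => hρ.1
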